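/- Write $\langle\xi\rangle=\sqrt{1+|\xi|^2}$ and $\langle\nabla\rangle=\sqrt{1-\Delta}$. Let $H^s(\mathbb{R}^d)$ carry the norm $\|f\|_{H^s}=\|\langle\nabla\rangle^s f\|_{L^2}$. Fix $\psi\in C^\infty(\mathbb{R}^d;\mathbb{R})$ with $\psi(\xi)=1$ for $|\xi|\le 1$ and $\psi(\xi)=0$ for $|\xi|\ge 2$, let $P_0$ be the Fourier multiplier with symbol $\psi(\xi)$ and, for $j\ge 1$, $P_j$ the Fourier multiplier with symbol $\psi(2^{-j}\xi)-\psi(2^{1-j}\xi)$, and let the inhomogeneous Besov space $B^0_{\infty,2}(\mathbb{R}^d)$ carry the norm $$\|u\|_{B^0_{\infty,2}}=\Bigl(\sum_{j\ge 0}\|P_ju\|_{L^\infty}^2\Bigr)^{1/2}.$$ Let $d\ge 1$ be an integer, $\chi\in\mathcal{S}(\mathbb{R}^d)$ a (complex-valued) Schwartz function, $\alpha\in[0,d/2]$ and $R_0>0$. Then there is a constant $C>0$, depending only on $d$, $\psi$, $\chi$, $\alpha$ and $R_0$, such that for all $R\ge R_0$, all $t\in\mathbb{R}$ and all complex-valued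 $f\in H^{d/2-\alpha}(\mathbb{R}^d)$, with $\chi_R(x)=\chi(x/R)$, $$\bigl\|e^{it\langle\nabla\rangle}\langle\nabla\rangle^{-\alpha}(\chi_R f)\bigr\|_{B^0_{\infty,2}}\le C\,\langle t/R\rangle^{(1-d)/2}\,\|f\|_{H^{d/2-\alpha}}.$$ -/

import Mathlib

open MeasureTheory
open scoped SchwartzMap ENNReal ContDiff

noncomputable section

namespace KG

/-- The Euclidean space `ℝ^d`. -/
abbrev Space (d : ℕ) : Type := EuclideanSpace ℝ (Fin d)

/-- The Japanese bracket `⟨v⟩ = √(1 + |v|²)`. -/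
def bracket {V : Type*} [NormedAddCommGroup V] (v : V) : ℝ := Real.sqrt (1 + ‖v‖ ^ 2)

/-- The Fourier multiplier `m(-i∇)` on tempered distributions, with `m` a function of temperate
growth of the angular frequency. Mathlib's Fourier transform has kernel `e^{-2πi⟨x, ξ⟩}`, so the
angular frequency is `2πξ`. -/
def multiplier {d : ℕ} (m : Space d → ℂ) : 𝓢'(Space d, ℂ) →L[ℂ] 𝓢'(Space d, ℂ) :=
  TemperedDistribution.fourierMultiplierCLM ℂ (fun ξ ↦ m ((2 * Real.pi) • ξ))

/-- `⟨∇⟩^s = (1 - Δ)^{s/2}`. -/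
def bracketNabla {d : ℕ} (s : ℝ) : 𝓢'(Space d, ℂ) →L[ℂ] 𝓢'(Space d, ℂ) :=
  multiplier (fun ξ ↦ ((bracket ξ ^ s : ℝ) : ℂ))

/-- The (half) Klein-Gordon propagator `e^{it⟨∇⟩}`. -/
def propagator {d : ℕ} (t : ℝ) : 𝓢'(Space d, ℂ) →L[ℂ] 𝓢'(Space d, ℂ) :=
  multiplier (fun ξ ↦ Complex.exp (Complex.I * ((t * bracket ξ : ℝ) : ℂ)))

/-- Multiplication of a tempered distribution by the function `x ↦ χ(x / R)`. -/
def localize {d : ℕ} (χ : 𝓢(Space d, ℂ)) (R : ℝ) : 𝓢'(Space d, ℂ) →L[ℂ] 𝓢'(Space d, ℂ) :=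
  TemperedDistribution.smulLeftCLM ℂ (fun x ↦ χ (R⁻¹ • x))

/-- The `L^p` norm of a tempered distribution; it is `∞` if the distribution is not represented by
an `L^p` function (the representing function is unique if it exists). -/
def lpNorm {d : ℕ} (p : ℝ≥0∞) [Fact (1 ≤ p)] (u : 𝓢'(Space d, ℂ)) : ℝ≥0∞ :=
  ⨅ (g : Lp ℂ p (volume : Measure (Space d))) (_ : (g : 𝓢'(Space d, ℂ)) = u), ‖g‖ₑ

/-- The norm of the Sobolev space `H^s`, `‖u‖_{H^s} = ‖⟨∇⟩^s u‖_{L²}`. -/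
def sobolevNorm {d : ℕ} (s : ℝ) (u : 𝓢'(Space d, ℂ)) : ℝ≥0∞ :=
  lpNorm 2 (bracketNabla s u)

/-- A smooth low-frequency cut-off from which a Littlewood-Paley decomposition is built. -/
structure IsCutoff {d : ℕ} (ψ : Space d → ℝ) : Prop where
  smooth : ContDiff ℝ ∞ ψ
  eq_one : ∀ ξ, ‖ξ‖ ≤ 1 → ψ ξ = 1
  eq_zero : ∀ ξ, 2 ≤ ‖ξ‖ → ψ ξ = 0

/-- The symbols of the inhomogeneous Littlewood-Paley decomposition: `ψ` itself for `j = 0`, and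
`ψ(2^{-j}ξ) - ψ(2^{1-j}ξ)`, which is supported in `2^{j-1} ≤ |ξ| ≤ 2^{j+1}`, for `j ≥ 1`.
They add up to `1`. -/
def dyadicSymbol {d : ℕ} (ψ : Space d → ℝ) : ℕ → Space d → ℝ
  | 0, ξ => ψ ξ
  | j + 1, ξ => ψ (((2 : ℝ) ^ (j + 1))⁻¹ • ξ) - ψ (((2 : ℝ) ^ j)⁻¹ • ξ)

/-- The Littlewood-Paley projection onto the `j`-th dyadic frequency range. -/
def dyadicBlock {d : ℕ} (ψ : Space d → ℝ) (j : ℕ) : 𝓢'(Space d, ℂ) →L[ℂ] 𝓢'(Space d, ℂ) :=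
  multiplier (fun ξ ↦ (dyadicSymbol ψ j ξ : ℂ))

/-- The norm of the inhomogeneous Besov space `B^σ_{p,q}`, `q < ∞`, computed with the
Littlewood-Paley decomposition built from `ψ`:
`‖u‖ = (∑_{j ≥ 0} (2^{jσ} ‖P_j u‖_{L^p})^q)^{1/q}`. -/
def besovNorm {d : ℕ} (ψ : Space d → ℝ) (σ : ℝ) (p : ℝ≥0∞) [Fact (1 ≤ p)] (q : ℝ)
    (u : 𝓢'(Space d, ℂ)) : ℝ≥0∞ :=
  (∑' j : ℕ, ((2 : ℝ≥0∞) ^ (j * σ) * lpNorm p (dyadicBlock ψ j u)) ^ q) ^ (1 / q)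

end KG

end

/-!
# Decay of the localized free Klein-Gordon flow in `B^0_{∞,2}`

The dyadic piece `P_j e^{it⟨∇⟩} ⟨∇⟩^{-α} (χ(· / R) f)` is the convolution of
`w_j = P_j (χ(· / R) f)` with a kernel `K_j`, the inverse Fourier transform of `kernelSymbol α t j`:
the symbol `e^{it⟨ξ⟩} ⟨ξ⟩^{-α}`, cut off by a *radial* bump that equals `1` on the support of the
symbol of `P_j`. (The cut-off `ψ` itself need not be radial.) The function `w_j` is concentrated in
the ball of radius `R`, so Cauchy-Schwarz with the weight `(1 + |y| / R)^{2d}`, whose inverse is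
`ballWeight`, bounds `|K_j * w_j (x)|²` by the product of the mass of `|K_j|²` in the ball of radius
`R` about `x` and the weighted `L²` norm of `w_j`.

*The kernels.* The mass of `|K_j|²` in a ball of radius `R` is at most
`C 2^{j(d - 2α)} ⟨t / R⟩^{1 - d}`, see `exists_lintegral_kernel_ballWeight_le`. For `|t| ≤ R` this is
Plancherel. For `|t| ≥ R`, the gradient of the phase `t⟨ξ⟩` is radial, and integrating by parts
in the radial direction on the Fourier side gives
`|t|^{d-1} ∫ |K_j(z)|² |z|^{1-d} dz ≤ C 2^{j(d - 2α)}`, see `exists_lintegral_radialWeight_kernel_le`.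
A high frequency is scaled to unit frequency, where the rescaled phases form a bounded family. The
kernel at low frequencies is a sum of pieces at the frequencies `2^{-k}`, on which the
oscillation of the phase `t⟨ξ⟩` is of size `t 2^{-2k}`; their contributions form a geometric series. Finally
`K_j` is radial, and a ball of radius `R` meets each sphere `|z| = r` in at most the fraction
`C (R / r)^{d-1}` of its area (`exists_sphere_ballWeight_le`), so that the weight `|z|^{1-d}` turns
into the factor `R^{d-1}` (`exists_lintegral_radial_le`).

*The square function.* With `s = d / 2 - α`,
`∑_j 2^{2js} ∫ (1 + |y| / R)^{2d} |w_j(y)|² dy ≤ C ‖f‖²_{H^s}`, uniformly in `R ≥ R₀`, see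
`exists_tsum_lintegral_ballWeight_le`. Without the weight this follows from the bounded overlap of the
dyadic symbols and the boundedness of multiplication by `χ(· / R)` on `H^s` (Peetre's inequality and
Young's inequality). The weight reduces to powers of `y_m / R`; commuting such a factor with a Fourier
multiplier either puts it on `χ`, which remains a Schwartz function of `x / R`, or differentiates
the symbol, which gains `1 / R ≤ 1 / R₀` and preserves the dyadic structure.

Summing over `j` gives the estimate on Schwartz functions (`exists_tsum_localizedFlow_le`). Since
`f = ⟨∇⟩^{-s} g` with `g` in `L²`, it extends to all of `H^s` by density of the Schwartz functions in
`L²` (`tsum_lpNorm_top_le`).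
-/

noncomputable section

namespace KG

open FourierTransform LineDeriv

variable {d : ℕ}

/-! ### The Japanese bracket -/

section Bracket

variable {V : Type*} [NormedAddCommGroup V]

lemma one_le_bracket (v : V) : 1 ≤ bracket v :=
  Real.one_le_sqrt.2 (le_add_of_nonneg_right (by positivity))

lemma bracket_pos (v : V) : 0 < bracket v := zero_lt_one.trans_le (one_le_bracket v)

lemma bracket_sq (v : V) : bracket v ^ 2 = 1 + ‖v‖ ^ 2 := Real.sq_sqrt (by positivity)

lemma norm_le_bracket (v : V) : ‖v‖ ≤ bracket v := Real.le_sqrt_of_sq_le (by linarith)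

lemma bracket_rpow (v : V) (s : ℝ) : bracket v ^ s = (1 + ‖v‖ ^ 2) ^ (s / 2) := by
  rw [bracket, Real.sqrt_eq_rpow, ← Real.rpow_mul (by positivity)]
  congr 1; ring

/-- Peetre's inequality. -/
lemma bracket_add_le (v w : V) : bracket (v + w) ≤ 2 * (bracket v * bracket w) := by
  have hv := bracket_sq v
  have hw := bracket_sq w
  have hvw := bracket_sq (v + w)
  refine le_of_sq_le_sq ?_ (mul_nonneg zero_le_two
    (mul_nonneg (bracket_pos v).le (bracket_pos w).le))
  have h := norm_add_le v w
  have h2 : ‖v + w‖ ^ 2 ≤ (‖v‖ + ‖w‖) ^ 2 := by gcongr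
  rw [hvw, mul_pow, mul_pow, hv, hw]
  nlinarith [sq_nonneg (‖v‖ - ‖w‖), sq_nonneg ‖v‖, sq_nonneg ‖w‖,
    mul_nonneg (sq_nonneg ‖v‖) (sq_nonneg ‖w‖)]

end Bracket

lemma contDiff_bracket : ContDiff ℝ ∞ (bracket : Space d → ℝ) := by
  unfold bracket
  exact ((contDiff_const.add (contDiff_norm_sq ℝ))).sqrt (fun x ↦ by positivity)

lemma contDiff_bracket_smul (c : ℝ) : ContDiff ℝ ∞ fun ξ : Space d ↦ bracket (c • ξ) :=
  contDiff_bracket.comp (contDiff_id.const_smul c)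

lemma hasTemperateGrowth_bracket_rpow (s : ℝ) (c : ℝ) :
    (fun ξ : Space d ↦ ((bracket (c • ξ) ^ s : ℝ) : ℂ)).HasTemperateGrowth := by
  have h1 : (fun ξ : Space d ↦ (1 + ‖ξ‖ ^ 2) ^ (s / 2)).HasTemperateGrowth :=
    Function.hasTemperateGrowth_one_add_norm_sq_rpow _ _
  have h2 : (fun ξ : Space d ↦ c • ξ).HasTemperateGrowth :=
    (c • ContinuousLinearMap.id ℝ (Space d)).hasTemperateGrowth
  have h3 := Function.Complex.hasTemperateGrowth_ofReal.comp (h1.comp h2)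
  have h : (fun ξ : Space d ↦ ((bracket (c • ξ) ^ s : ℝ) : ℂ)) =
      Complex.ofReal ∘ (fun ξ : Space d ↦ (1 + ‖ξ‖ ^ 2) ^ (s / 2)) ∘ fun ξ ↦ c • ξ := by
    funext ξ
    simp only [Function.comp_apply, bracket_rpow]
  rwa [h]

lemma hasTemperateGrowth_exp_I_mul :
    (fun y : ℝ ↦ Complex.exp (Complex.I * (y : ℂ))).HasTemperateGrowth := by
  have hc : ContDiff ℝ ∞ (fun y : ℝ ↦ Complex.exp (Complex.I * (y : ℂ))) :=
    (contDiff_const.mul Complex.ofRealCLM.contDiff).cexp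
  refine ⟨hc, fun n ↦ ⟨0, 1, fun x ↦ ?_⟩⟩
  have key : ∀ n : ℕ, iteratedDeriv n (fun y : ℝ ↦ Complex.exp (Complex.I * (y : ℂ))) =
      fun y : ℝ ↦ Complex.I ^ n * Complex.exp (Complex.I * (y : ℂ)) := by
    intro n
    induction n with
    | zero => simp
    | succ n ih =>
      rw [iteratedDeriv_succ, ih]
      funext y
      have h : HasDerivAt (fun y : ℝ ↦ Complex.exp (Complex.I * (y : ℂ)))
          (Complex.exp (Complex.I * (y : ℂ)) * (Complex.I * 1)) y :=
        ((Complex.ofRealCLM.hasDerivAt (x := y)).const_mul Complex.I).cexp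
      rw [(h.const_mul _).deriv]
      ring
  rw [norm_iteratedFDeriv_eq_norm_iteratedDeriv, key]
  simp [Complex.norm_exp]

lemma hasTemperateGrowth_propagator (t c : ℝ) :
    (fun ξ : Space d ↦
      Complex.exp (Complex.I * ((t * bracket (c • ξ) : ℝ) : ℂ))).HasTemperateGrowth := by
  have h1 : (fun ξ : Space d ↦ (1 + ‖ξ‖ ^ 2) ^ ((1 : ℝ) / 2)).HasTemperateGrowth :=
    Function.hasTemperateGrowth_one_add_norm_sq_rpow _ _
  have h2 : (fun ξ : Space d ↦ c • ξ).HasTemperateGrowth :=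
    (c • ContinuousLinearMap.id ℝ (Space d)).hasTemperateGrowth
  have h3 : (fun y : ℝ ↦ t * y).HasTemperateGrowth :=
    (t • ContinuousLinearMap.id ℝ ℝ).hasTemperateGrowth
  have h4 := hasTemperateGrowth_exp_I_mul.comp (h3.comp (h1.comp h2))
  convert h4 using 2 with ξ
  simp [bracket, Real.sqrt_eq_rpow]

/-! ### Families of symbols supported in an annulus -/

/-- A family of symbols `b(ε, η)`, depending smoothly on the parameter `ε` and the frequency `η`
together, and supported in a fixed annulus `c ≤ |η| ≤ C`. Bounds that are uniform in `ε ∈ [0, 1]`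
follow from compactness, for `b` and for all its derivatives. -/
structure IsAnnular (b : ℝ × Space d → ℂ) : Prop where
  smooth : ContDiff ℝ ∞ b
  support : ∃ c > 0, ∃ C, ∀ p, b p ≠ 0 → c ≤ ‖p.2‖ ∧ ‖p.2‖ ≤ C

namespace IsAnnular

variable {b : ℝ × Space d → ℂ}

lemma mul (hb : IsAnnular b) {q : ℝ × Space d → ℂ}
    (hq : ∀ p, p.2 ≠ 0 → ContDiffAt ℝ ∞ q p) : IsAnnular (fun p ↦ q p * b p) := by
  obtain ⟨c, hc, C, hcC⟩ := hb.support
  refine ⟨contDiff_iff_contDiffAt.2 fun p ↦ ?_, c, hc, C, fun p hp ↦ hcC p (right_ne_zero_of_mul hp)⟩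
  by_cases hp : p.2 = 0
  · have hev : ∀ᶠ x in nhds p, ‖x.2‖ < c :=
      (continuous_snd.norm.tendsto p).eventually_lt_const (by simpa [hp] using hc)
    refine (contDiffAt_const (c := (0 : ℂ))).congr_of_eventuallyEq ?_
    filter_upwards [hev] with x hx
    have : b x = 0 := by
      by_contra h
      exact absurd (hcC x h).1 (not_le.2 hx)
    simp [this]
  · exact (hq p hp).mul hb.smooth.contDiffAt

lemma lineDeriv (hb : IsAnnular b) (v : Space d) :
    IsAnnular (fun p ↦ fderiv ℝ b p (0, v)) := by
  obtain ⟨c, hc, C, hcC⟩ := hb.support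
  refine ⟨(hb.smooth.fderiv_right (m := ∞) le_rfl).clm_apply contDiff_const, c, hc, C,
    fun p hp ↦ ?_⟩
  have hclosed : IsClosed {p : ℝ × Space d | c ≤ ‖p.2‖ ∧ ‖p.2‖ ≤ C} :=
    (isClosed_le continuous_const continuous_snd.norm).inter
      (isClosed_le continuous_snd.norm continuous_const)
  have hsub : tsupport b ⊆ {p : ℝ × Space d | c ≤ ‖p.2‖ ∧ ‖p.2‖ ≤ C} :=
    closure_minimal (fun p hp ↦ hcC p hp) hclosed
  apply hsub
  apply support_fderiv_subset ℝ
  intro h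
  simp [h] at hp

lemma contDiff_slice (hb : IsAnnular b) (ε : ℝ) : ContDiff ℝ ∞ fun η ↦ b (ε, η) :=
  hb.smooth.comp (contDiff_const.prodMk contDiff_id)

lemma exists_radius (hb : IsAnnular b) :
    ∃ C, ∀ ε η, η ∉ Metric.closedBall (0 : Space d) C → b (ε, η) = 0 := by
  obtain ⟨c, hc, C, hcC⟩ := hb.support
  refine ⟨C, fun ε η hη ↦ ?_⟩
  by_contra h
  exact hη (by simpa using (hcC _ h).2)

lemma hasCompactSupport_slice (hb : IsAnnular b) (ε : ℝ) :
    HasCompactSupport fun η ↦ b (ε, η) := by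
  obtain ⟨C, hC⟩ := hb.exists_radius
  exact HasCompactSupport.intro (isCompact_closedBall 0 C) fun η hη ↦ hC ε η hη

lemma exists_bound (hb : IsAnnular b) :
    ∃ M : ℝ, 0 ≤ M ∧ ∀ ε ∈ Set.Icc (0 : ℝ) 1, ∀ η, ‖b (ε, η)‖ ≤ M := by
  obtain ⟨C, hC⟩ := hb.exists_radius
  have hK : IsCompact (Set.Icc (0 : ℝ) 1 ×ˢ Metric.closedBall (0 : Space d) C) :=
    isCompact_Icc.prod (isCompact_closedBall _ _)
  obtain ⟨M, hM⟩ := hK.exists_bound_of_continuousOn (f := b) hb.smooth.continuous.continuousOn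
  refine ⟨max M 0, le_max_right _ _, fun ε hε η ↦ ?_⟩
  by_cases hη : η ∈ Metric.closedBall (0 : Space d) C
  · exact (hM (ε, η) ⟨hε, hη⟩).trans (le_max_left _ _)
  · simp [hC ε η hη]

/-- The slices of an annular family are bounded in `L^p`, uniformly in the parameter. -/
lemma exists_eLpNorm_le (hb : IsAnnular b) (p : ℝ≥0∞) :
    ∃ M : ℝ≥0∞, M ≠ ⊤ ∧ ∀ ε ∈ Set.Icc (0 : ℝ) 1, eLpNorm (fun η ↦ b (ε, η)) p volume ≤ M := by
  obtain ⟨C, hC⟩ := hb.exists_radius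
  obtain ⟨M, hM0, hM⟩ := hb.exists_bound
  have hball : MemLp ((Metric.closedBall (0 : Space d) C).indicator fun _ ↦ M) p volume :=
    memLp_indicator_const p Metric.isClosed_closedBall.measurableSet M
      (Or.inr (measure_closedBall_lt_top).ne)
  refine ⟨_, hball.eLpNorm_ne_top, fun ε hε ↦ eLpNorm_mono_real fun η ↦ ?_⟩
  by_cases hη : η ∈ Metric.closedBall (0 : Space d) C
  · simpa [Set.indicator_of_mem hη] using hM ε hε η
  · simp [hC ε η hη]
    exact Set.indicator_nonneg (fun _ _ ↦ hM0) _

end IsAnnular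

/-! ### Non-stationary phase -/

/-- Plancherel's theorem for the inverse Fourier transform of a Schwartz function. -/
lemma eLpNorm_fourierInv (f : 𝓢(Space d, ℂ)) :
    eLpNorm (𝓕⁻ f : 𝓢(Space d, ℂ)) 2 volume = eLpNorm f 2 volume := by
  have h := congrArg ENNReal.ofReal (SchwartzMap.norm_fourier_toL2_eq (𝓕⁻ f))
  rw [FourierTransform.fourier_fourierInv_eq, SchwartzMap.norm_toLp, SchwartzMap.norm_toLp,
    ENNReal.ofReal_toReal (SchwartzMap.eLpNorm_lt_top _ _ volume).ne,
    ENNReal.ofReal_toReal (SchwartzMap.eLpNorm_lt_top _ _ volume).ne] at h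
  exact h.symm

lemma eLpNorm_fourier (f : 𝓢(Space d, ℂ)) :
    eLpNorm (𝓕 f : 𝓢(Space d, ℂ)) 2 volume = eLpNorm f 2 volume := by
  rw [← eLpNorm_fourierInv (𝓕 f), FourierTransform.fourierInv_fourier_eq]

lemma hasFDerivAt_bracket_smul (c : ℝ) (η : Space d) :
    HasFDerivAt (fun η : Space d ↦ bracket (c • η))
      ((c ^ 2 / bracket (c • η)) • innerSL ℝ η) η := by
  have h1 : HasFDerivAt (fun η : Space d ↦ 1 + c ^ 2 * ‖η‖ ^ 2)
      (c ^ 2 • (2 • innerSL ℝ η)) η :=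
    ((hasStrictFDerivAt_norm_sq η).hasFDerivAt.const_mul (c ^ 2)).const_add 1
  have h2 := h1.sqrt (by positivity)
  have h3 : (fun η : Space d ↦ bracket (c • η)) = fun η ↦ √(1 + c ^ 2 * ‖η‖ ^ 2) := by
    funext η
    simp [bracket, norm_smul, mul_pow]
  rw [h3, show bracket (c • η) = √(1 + c ^ 2 * ‖η‖ ^ 2) from congrFun h3 η]
  refine h2.congr_fderiv ?_
  ext v
  simp
  field_simp

/-- The oscillating symbol `η ↦ e^{it⟨2πση⟩} b(ε, η)`. -/
def oscSymbol {b : ℝ × Space d → ℂ} (hb : IsAnnular b) (ε σ t : ℝ) : 𝓢(Space d, ℂ) :=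
  HasCompactSupport.toSchwartzMap
    (f := fun η ↦ Complex.exp (Complex.I * ((t * bracket ((2 * Real.pi * σ) • η) : ℝ) : ℂ)) *
      b (ε, η))
    (hb.hasCompactSupport_slice ε).mul_left
    ((hasTemperateGrowth_propagator t (2 * Real.pi * σ)).1.mul (hb.contDiff_slice ε))

lemma oscSymbol_apply {b : ℝ × Space d → ℂ} (hb : IsAnnular b) (ε σ t : ℝ) (η : Space d) :
    oscSymbol hb ε σ t η =
      Complex.exp (Complex.I * ((t * bracket ((2 * Real.pi * σ) • η) : ℝ) : ℂ)) * b (ε, η) := rfl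

lemma norm_oscSymbol {b : ℝ × Space d → ℂ} (hb : IsAnnular b) (ε σ t : ℝ) (η : Space d) :
    ‖oscSymbol hb ε σ t η‖ = ‖b (ε, η)‖ := by
  rw [oscSymbol_apply, norm_mul, mul_comm Complex.I, Complex.norm_exp_ofReal_mul_I, one_mul]

lemma lineDeriv_oscSymbol {b : ℝ × Space d → ℂ} (hb : IsAnnular b) (ε σ t : ℝ)
    (v η : Space d) :
    (∂_{v} (oscSymbol hb ε σ t) : 𝓢(Space d, ℂ)) η =
      oscSymbol (hb.lineDeriv v) ε σ t η +
        Complex.I * ((t * ((2 * Real.pi * σ) ^ 2 / bracket ((2 * Real.pi * σ) • η)) *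
          inner ℝ η v : ℝ) : ℂ) * oscSymbol hb ε σ t η := by
  set c := 2 * Real.pi * σ
  have h1 : HasFDerivAt (fun η : Space d ↦ ((t * bracket (c • η) : ℝ) : ℂ))
      (Complex.ofRealCLM ∘L (t • ((c ^ 2 / bracket (c • η)) • innerSL ℝ η))) η :=
    Complex.ofRealCLM.hasFDerivAt.comp η ((hasFDerivAt_bracket_smul c η).const_mul t)
  have h2 := (h1.const_mul Complex.I).cexp
  have h3 : HasFDerivAt (fun η ↦ b (ε, η))
      (fderiv ℝ b (ε, η) ∘L ContinuousLinearMap.inr ℝ ℝ (Space d)) η :=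
    ((hb.smooth.differentiable (by simp)) (ε, η)).hasFDerivAt.comp η (hasFDerivAt_prodMk_right ε η)
  have h4 : fderiv ℝ (fun η ↦ Complex.exp (Complex.I * ((t * bracket (c • η) : ℝ) : ℂ)) *
      b (ε, η)) η = _ := (h2.mul h3).fderiv
  rw [SchwartzMap.lineDerivOp_apply_eq_fderiv]
  have h5 : (oscSymbol hb ε σ t : Space d → ℂ) = fun η ↦
      Complex.exp (Complex.I * ((t * bracket (c • η) : ℝ) : ℂ)) * b (ε, η) := rfl
  rw [h5, h4]
  simp only [oscSymbol_apply, show 2 * Real.pi * σ = c from rfl]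
  simp
  ring

/-- Integration by parts along the radial field: the kernel of `e^{it⟨2πση⟩} b` gains a factor
`(1 + |z|) / |τ|`, where `τ / q` is the derivative of the phase
along the Euler field `η · ∇`. -/
lemma norm_fourierInv_oscSymbol_le {b : ℝ × Space d → ℂ} (hb : IsAnnular b)
    {q : ℝ × Space d → ℝ} (hq : ∀ p, p.2 ≠ 0 → ContDiffAt ℝ ∞ q p) :
    ∃ (b₁ b₂ : Fin d → ℝ × Space d → ℂ) (h₁ : ∀ k, IsAnnular (b₁ k)) (h₂ : ∀ k, IsAnnular (b₂ k)),
      ∀ ε σ t τ : ℝ, (∀ η : Space d, η ≠ 0 → t * (2 * Real.pi * σ) ^ 2 * ‖η‖ ^ 2 * q (ε, η) =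
        τ * bracket ((2 * Real.pi * σ) • η)) → ∀ z,
      |τ| * ‖𝓕⁻ (oscSymbol hb ε σ t) z‖ ≤ 2 * Real.pi * (1 + ‖z‖) *
        ∑ k, (‖𝓕⁻ (oscSymbol (h₁ k) ε σ t) z‖ + ‖𝓕⁻ (oscSymbol (h₂ k) ε σ t) z‖) := by
  have hq' : ∀ (k : Fin d) (p : ℝ × Space d), p.2 ≠ 0 →
      ContDiffAt ℝ ∞ (fun p : ℝ × Space d ↦ ((p.2 k * q p : ℝ) : ℂ)) p := fun k p hp ↦ by
    have : ContDiffAt ℝ ∞ (fun p : ℝ × Space d ↦ p.2 k) p :=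
      ((EuclideanSpace.proj k : Space d →L[ℝ] ℝ).contDiff.comp contDiff_snd).contDiffAt
    exact Complex.ofRealCLM.contDiff.contDiffAt.comp p (this.mul (hq p hp))
  set e : Fin d → Space d := fun k ↦ EuclideanSpace.single k (1 : ℝ)
  refine ⟨_, _, fun k ↦ hb.mul (hq' k), fun k ↦ (hb.mul (hq' k)).lineDeriv (e k),
    fun ε σ t τ hτ z ↦ ?_⟩
  set c := 2 * Real.pi * σ
  have key : ∑ k, (∂_{e k} (oscSymbol (hb.mul (hq' k)) ε σ t) : 𝓢(Space d, ℂ)) =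
      ∑ k, oscSymbol ((hb.mul (hq' k)).lineDeriv (e k)) ε σ t +
        (Complex.I * (τ : ℂ)) • oscSymbol hb ε σ t := by
    ext η
    simp only [FunLike.coe_sum, Finset.sum_apply, add_apply, smul_apply, smul_eq_mul,
      lineDeriv_oscSymbol, Finset.sum_add_distrib]
    congr 1
    by_cases hη : η = 0
    · have : b (ε, η) = 0 := by
        obtain ⟨r, hr, C, hC⟩ := hb.support
        by_contra h
        have := (hC _ h).1
        simp [hη] at this
        linarith
      simp [oscSymbol_apply, this]
    · have hbr := (bracket_pos (c • η)).ne'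
      have h1 : ∑ k, η k ^ 2 = ‖η‖ ^ 2 := by
        rw [EuclideanSpace.real_norm_sq_eq]
      have h2 : ∑ k : Fin d, t * (c ^ 2 / bracket (c • η)) * inner ℝ η (e k) * (η k * q (ε, η))
          = τ := by
        have : ∀ k : Fin d, t * (c ^ 2 / bracket (c • η)) * inner ℝ η (e k) * (η k * q (ε, η)) =
            t * (c ^ 2 / bracket (c • η)) * q (ε, η) * η k ^ 2 := fun k ↦ by
          have : inner ℝ η (e k) = η k := by simp [e, EuclideanSpace.inner_single_right]
          rw [this]; ring
        rw [Finset.sum_congr rfl fun k _ ↦ this k, ← Finset.mul_sum, h1]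
        have := hτ η hη
        field_simp
        linarith
      rw [← h2]
      push_cast
      rw [Finset.mul_sum, Finset.sum_mul]
      refine Finset.sum_congr rfl fun k _ ↦ ?_
      simp only [oscSymbol_apply, show 2 * Real.pi * σ = c from rfl]
      push_cast
      rw [show (c : ℂ) = 2 * Real.pi * σ by simp [c]]
      ring
  have key2 := congrArg (fun f : 𝓢(Space d, ℂ) ↦ (𝓕⁻ f : 𝓢(Space d, ℂ)) z) key
  have hsum : ∀ g : Fin d → 𝓢(Space d, ℂ), (𝓕⁻ (∑ k, g k) : 𝓢(Space d, ℂ)) z = ∑ k, 𝓕⁻ (g k) z := by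
    intro g
    rw [show (𝓕⁻ (∑ k, g k) : 𝓢(Space d, ℂ)) = ∑ k, 𝓕⁻ (g k) from
      map_sum (fourierInvCLM ℂ 𝓢(Space d, ℂ)) g _]
    simp
  have hinner : ∀ m : Space d, (fun x : Space d ↦ inner ℝ x m).HasTemperateGrowth := fun m ↦ by
    fun_prop
  simp only [FourierTransform.fourierInv_add, add_apply, hsum, FourierTransform.fourierInv_smul,
    smul_apply, SchwartzMap.fourierInv_lineDerivOp_eq,
    SchwartzMap.smulLeftCLM_apply_apply (hinner _)] at key2
  set F := (𝓕⁻ (oscSymbol hb ε σ t) : 𝓢(Space d, ℂ)) z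
  have hF : |τ| * ‖F‖ = ‖(Complex.I * (τ : ℂ)) • F‖ := by simp
  rw [hF, eq_sub_of_add_eq' key2.symm, Finset.mul_sum]
  rw [← Finset.sum_sub_distrib]
  refine (norm_sum_le _ _).trans (Finset.sum_le_sum fun k _ ↦ (norm_sub_le _ _).trans ?_)
  have hk : ‖inner ℝ z (e k)‖ ≤ ‖z‖ :=
    (norm_inner_le_norm _ _).trans (by simp [e])
  have hpi : (1 : ℝ) ≤ 2 * Real.pi := by linarith [Real.pi_gt_three]
  rw [mul_add]
  refine add_le_add ?_ ?_
  · rw [norm_smul, norm_smul, ← mul_assoc]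
    refine mul_le_mul_of_nonneg_right ?_ (norm_nonneg _)
    have : ‖-(2 * (Real.pi : ℂ) * Complex.I)‖ = 2 * Real.pi := by
      simp [abs_of_pos Real.pi_pos]
    rw [this]
    refine mul_le_mul_of_nonneg_left ?_ (by positivity)
    linarith
  · refine le_mul_of_one_le_left (norm_nonneg _) ?_
    nlinarith [norm_nonneg z]

/-- Decay of the kernels of `e^{it⟨2πση⟩} b(ε, η)`, in `L^2` and in `L^∞`, uniformly in the
parameters: each power of the size `|τ|` of the phase costs one power of `1 + |z|`. -/
lemma exists_eLpNorm_fourierInv_oscSymbol_le {q : ℝ × Space d → ℝ}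
    (hq : ∀ p, p.2 ≠ 0 → ContDiffAt ℝ ∞ q p) {p : ℝ≥0∞} (hp : p = 2 ∨ p = ⊤) (N : ℕ)
    {b : ℝ × Space d → ℂ} (hb : IsAnnular b) :
    ∃ M : ℝ≥0∞, M ≠ ⊤ ∧ ∀ ε ∈ Set.Icc (0 : ℝ) 1, ∀ σ t τ : ℝ,
      (∀ η : Space d, η ≠ 0 → t * (2 * Real.pi * σ) ^ 2 * ‖η‖ ^ 2 * q (ε, η) =
        τ * bracket ((2 * Real.pi * σ) • η)) →
      eLpNorm (fun z ↦ (|τ| / (1 + ‖z‖)) ^ N * ‖𝓕⁻ (oscSymbol hb ε σ t) z‖) p volume ≤ M := by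
  have hp1 : 1 ≤ p := by rcases hp with rfl | rfl <;> simp
  induction N generalizing b with
  | zero =>
    rcases hp with rfl | rfl
    · obtain ⟨M, hM, hbM⟩ := hb.exists_eLpNorm_le 2
      refine ⟨M, hM, fun ε hε σ t τ _ ↦ ?_⟩
      simp only [pow_zero, one_mul, eLpNorm_norm]
      rw [eLpNorm_fourierInv]
      refine le_trans (le_of_eq ?_) (hbM ε hε)
      exact eLpNorm_congr_norm_ae (ae_of_all _ fun η ↦ norm_oscSymbol hb ε σ t η)
    · obtain ⟨M, hM, hbM⟩ := hb.exists_eLpNorm_le 1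
      refine ⟨M, hM, fun ε hε σ t τ _ ↦ ?_⟩
      simp only [pow_zero, one_mul, eLpNorm_norm]
      refine le_trans ?_ (hbM ε hε)
      have h1 : ∀ z, ‖𝓕⁻ (oscSymbol hb ε σ t) z‖ ≤ ‖(oscSymbol hb ε σ t).toLp 1‖ := fun z ↦ by
        rw [SchwartzMap.fourierInv_apply_eq]
        exact SchwartzMap.norm_fourier_apply_le_toLp_one _ _
      refine (eLpNormEssSup_le_of_ae_bound (ae_of_all _ h1)).trans ?_
      rw [SchwartzMap.norm_toLp, ENNReal.ofReal_toReal (SchwartzMap.eLpNorm_lt_top _ _ volume).ne]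
      exact (eLpNorm_congr_norm_ae (ae_of_all _ fun η ↦ norm_oscSymbol hb ε σ t η)).le
  | succ N ih =>
    obtain ⟨b₁, b₂, h₁, h₂, h⟩ := norm_fourierInv_oscSymbol_le hb hq
    choose M₁ hM₁ hbM₁ using fun k ↦ ih (h₁ k)
    choose M₂ hM₂ hbM₂ using fun k ↦ ih (h₂ k)
    refine ⟨ENNReal.ofReal (2 * Real.pi) * ∑ k, (M₁ k + M₂ k), ?_, fun ε hε σ t τ hτ ↦ ?_⟩
    · exact ENNReal.mul_ne_top ENNReal.ofReal_ne_top
        (ENNReal.sum_ne_top.2 fun k _ ↦ ENNReal.add_ne_top.2 ⟨hM₁ k, hM₂ k⟩)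
    set G : (b : ℝ × Space d → ℂ) → IsAnnular b → Space d → ℝ := fun b hb z ↦
      (|τ| / (1 + ‖z‖)) ^ N * ‖𝓕⁻ (oscSymbol hb ε σ t) z‖
    have hG : ∀ b (hb : IsAnnular b), AEStronglyMeasurable (G b hb) volume := fun b hb ↦ by
      refine Continuous.aestronglyMeasurable ?_
      refine Continuous.mul ((continuous_const.div (by fun_prop) fun z ↦ ?_).pow N)
        (SchwartzMap.continuous _).norm
      positivity
    have hpt : ∀ z, ‖(|τ| / (1 + ‖z‖)) ^ (N + 1) * ‖𝓕⁻ (oscSymbol hb ε σ t) z‖‖ ≤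
        (2 * Real.pi) * ∑ k, (G _ (h₁ k) z + G _ (h₂ k) z) := fun z ↦ by
      have hz : 0 < 1 + ‖z‖ := by positivity
      rw [Real.norm_of_nonneg (by positivity), pow_succ, mul_assoc]
      have h3 : |τ| / (1 + ‖z‖) * ‖𝓕⁻ (oscSymbol hb ε σ t) z‖ ≤ 2 * Real.pi *
          ∑ k, (‖𝓕⁻ (oscSymbol (h₁ k) ε σ t) z‖ + ‖𝓕⁻ (oscSymbol (h₂ k) ε σ t) z‖) := by
        rw [div_mul_eq_mul_div, div_le_iff₀ hz]
        refine (h ε σ t τ hτ z).trans (le_of_eq (by ring))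
      refine (mul_le_mul_of_nonneg_left h3 (by positivity)).trans (le_of_eq ?_)
      simp only [G, ← mul_add, ← Finset.mul_sum]
      ring
    refine (eLpNorm_mono_real hpt).trans ?_
    have h4 := eLpNorm_const_smul (2 * Real.pi) (fun z ↦ ∑ k, (G _ (h₁ k) z + G _ (h₂ k) z)) p
      (volume : Measure (Space d))
    have h5 : ‖2 * Real.pi‖ₑ = ENNReal.ofReal (2 * Real.pi) :=
      Real.enorm_of_nonneg (by positivity)
    rw [h5] at h4
    refine h4.le.trans (mul_le_mul_right ?_ _)
    have h6 : (fun z ↦ ∑ k, (G _ (h₁ k) z + G _ (h₂ k) z)) = ∑ k, (G _ (h₁ k) + G _ (h₂ k)) := by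
      ext z; simp
    rw [h6]
    refine (eLpNorm_sum_le (fun k _ ↦ (hG _ _).add (hG _ _)) hp1).trans
      (Finset.sum_le_sum fun k _ ↦ ?_)
    exact (eLpNorm_add_le (hG _ _) (hG _ _) hp1).trans
      (add_le_add (hbM₁ k ε hε σ t τ hτ) (hbM₂ k ε hε σ t τ hτ))

/-! ### The weight `|z|^{1 - d}` and dilations -/

lemma eLpNorm_two_sq {X F : Type*} [MeasurableSpace X] [NormedAddCommGroup F] (f : X → F)
    (μ : Measure X) : eLpNorm f 2 μ ^ 2 = ∫⁻ x, ‖f x‖ₑ ^ 2 ∂μ := by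
  have := eLpNorm_nnreal_pow_eq_lintegral (f := f) (μ := μ) (p := 2) two_ne_zero
  simpa using this

/-- The weight `|z|^{1 - d}`: the reciprocal of the area growth of spheres. -/
def radialWeight (z : Space d) : ℝ≥0∞ := ENNReal.ofReal (‖z‖ ^ (d - 1))⁻¹

lemma measurable_radialWeight : Measurable (radialWeight : Space d → ℝ≥0∞) := by
  unfold radialWeight; fun_prop

lemma lintegral_ball_radialWeight_lt_top (hd : 1 ≤ d) :
    ∫⁻ z in Metric.ball (0 : Space d) 1, radialWeight z < ⊤ := by
  have : Nontrivial (Space d) := by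
    have : Nonempty (Fin d) := ⟨⟨0, hd⟩⟩
    infer_instance
  have h : IntegrableOn (fun z : Space d ↦ (‖z‖ ^ (d - 1))⁻¹) (Metric.ball 0 1) volume := by
    rw [integrableOn_fun_norm_addHaar (volume : Measure (Space d))
      (f := fun r : ℝ ↦ (r ^ (d - 1))⁻¹)]
    have h1 : IntegrableOn (fun _ : ℝ ↦ (1 : ℝ)) (Set.Ioo 0 1) volume :=
      integrableOn_const (by simp)
    refine h1.congr_fun (fun y hy ↦ ?_) measurableSet_Ioo
    have : y ^ (d - 1) ≠ 0 := pow_ne_zero _ hy.1.ne'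
    simp [this]
  exact h.lintegral_lt_top

/-- Uniform decay of the kernels of `e^{it⟨2πση⟩} b(ε, η)` in the space `L^2(|z|^{1 - d} dz)`. -/
lemma exists_lintegral_radialWeight_oscSymbol_le (hd : 1 ≤ d) {q : ℝ × Space d → ℝ}
    (hq : ∀ p, p.2 ≠ 0 → ContDiffAt ℝ ∞ q p) {b : ℝ × Space d → ℂ} (hb : IsAnnular b) :
    ∃ M : ℝ≥0∞, M ≠ ⊤ ∧ ∀ ε ∈ Set.Icc (0 : ℝ) 1, ∀ σ t τ : ℝ,
      (∀ η : Space d, η ≠ 0 → t * (2 * Real.pi * σ) ^ 2 * ‖η‖ ^ 2 * q (ε, η) =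
        τ * bracket ((2 * Real.pi * σ) • η)) →
      ENNReal.ofReal (|τ| ^ (d - 1)) *
        ∫⁻ z, ‖𝓕⁻ (oscSymbol hb ε σ t) z‖ₑ ^ 2 * radialWeight z ≤ M := by
  obtain ⟨A, hA, hbA⟩ :=
    exists_eLpNorm_fourierInv_oscSymbol_le hq (Or.inr rfl : (⊤ : ℝ≥0∞) = 2 ∨ _) (d - 1) hb
  obtain ⟨A₀, hA₀, hbA₀⟩ :=
    exists_eLpNorm_fourierInv_oscSymbol_le hq (Or.inr rfl : (⊤ : ℝ≥0∞) = 2 ∨ _) 0 hb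
  obtain ⟨L, hL, hbL⟩ :=
    exists_eLpNorm_fourierInv_oscSymbol_le hq (Or.inl rfl : (2 : ℝ≥0∞) = 2 ∨ _) (d - 1) hb
  obtain ⟨L₀, hL₀, hbL₀⟩ :=
    exists_eLpNorm_fourierInv_oscSymbol_le hq (Or.inl rfl : (2 : ℝ≥0∞) = 2 ∨ _) 0 hb
  set V := ∫⁻ z in Metric.ball (0 : Space d) 1, radialWeight z
  have hV : V ≠ ⊤ := (lintegral_ball_radialWeight_lt_top hd).ne
  refine ⟨ENNReal.ofReal (2 ^ (d - 1)) * (A * A₀ * V + (L ^ 2 + L₀ ^ 2)), ?_,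
    fun ε hε σ t τ hτ ↦ ?_⟩
  · finiteness
  set F : 𝓢(Space d, ℂ) := 𝓕⁻ (oscSymbol hb ε σ t)
  have hFc : Continuous F := F.continuous
  set G : Space d → ℝ := fun z ↦ (|τ| / (1 + ‖z‖)) ^ (d - 1) * ‖F z‖
  have hGc : Continuous G :=
    ((continuous_const.div (by fun_prop) fun z ↦ by positivity).pow _).mul hFc.norm
  have hGA : ∀ᵐ z, ‖G z‖ₑ ≤ A :=
    (ae_le_eLpNormEssSup (f := G)).mono fun z hz ↦ hz.trans (hbA ε hε σ t τ hτ)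
  have hFA : ∀ᵐ z, ‖F z‖ₑ ≤ A₀ := by
    have := hbA₀ ε hε σ t τ hτ
    simp only [pow_zero, one_mul, eLpNorm_norm] at this
    exact (ae_le_eLpNormEssSup (f := F)).mono fun z hz ↦ hz.trans this
  have hGL : ∫⁻ z, ‖G z‖ₑ ^ 2 ≤ L ^ 2 := by
    rw [← eLpNorm_two_sq]
    exact pow_le_pow_left' (hbL ε hε σ t τ hτ) 2
  have hFL : ∫⁻ z, ‖F z‖ₑ ^ 2 ≤ L₀ ^ 2 := by
    have := hbL₀ ε hε σ t τ hτ
    simp only [pow_zero, one_mul, eLpNorm_norm] at this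
    rw [← eLpNorm_two_sq]
    exact pow_le_pow_left' this 2
  -- `|τ|^{d-1} = (1 + |z|)^{d-1} (|τ| / (1 + |z|))^{d-1}`, and `(1 + |z|)^{d-1} |z|^{1-d}` is
  -- bounded away from the origin
  have hpt : ∀ z, ENNReal.ofReal (|τ| ^ (d - 1)) * (‖F z‖ₑ ^ 2 * radialWeight z) ≤
      ENNReal.ofReal (2 ^ (d - 1)) * (‖G z‖ₑ * ‖F z‖ₑ *
        (Metric.ball (0 : Space d) 1).indicator radialWeight z + ‖G z‖ₑ * ‖F z‖ₑ) := fun z ↦ by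
    have hz : (0 : ℝ) < 1 + ‖z‖ := by positivity
    have h1 : ENNReal.ofReal (|τ| ^ (d - 1)) * ‖F z‖ₑ =
        ENNReal.ofReal ((1 + ‖z‖) ^ (d - 1)) * ‖G z‖ₑ := by
      rw [← ofReal_norm, ← ofReal_norm, ← ENNReal.ofReal_mul (by positivity),
        ← ENNReal.ofReal_mul (by positivity), Real.norm_of_nonneg (by positivity : 0 ≤ G z),
        ← mul_assoc, ← mul_pow, mul_div_cancel₀ _ hz.ne']
    have h2 : ENNReal.ofReal ((1 + ‖z‖) ^ (d - 1)) * radialWeight z ≤ ENNReal.ofReal (2 ^ (d - 1)) *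
        ((Metric.ball (0 : Space d) 1).indicator radialWeight z + 1) := by
      by_cases hz1 : z ∈ Metric.ball (0 : Space d) 1
      · rw [Set.indicator_of_mem hz1]
        refine mul_le_mul' (ENNReal.ofReal_le_ofReal ?_) (le_add_right le_rfl)
        have : ‖z‖ < 1 := by simpa using hz1
        gcongr
        linarith
      · have : 1 ≤ ‖z‖ := by simpa using hz1
        rw [Set.indicator_of_notMem hz1, zero_add, mul_one, radialWeight,
          ← ENNReal.ofReal_mul (by positivity)]
        refine ENNReal.ofReal_le_ofReal ?_
        rw [← div_eq_mul_inv, div_le_iff₀ (by positivity), ← mul_pow]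
        gcongr
        linarith
    calc _ = (ENNReal.ofReal (|τ| ^ (d - 1)) * ‖F z‖ₑ) * ‖F z‖ₑ * radialWeight z := by ring
      _ = (ENNReal.ofReal ((1 + ‖z‖) ^ (d - 1)) * radialWeight z) * (‖G z‖ₑ * ‖F z‖ₑ) := by
        rw [h1]; ring
      _ ≤ _ := (mul_le_mul_left h2 _).trans (le_of_eq (by ring))
  have hGm : Measurable fun z ↦ ‖G z‖ₑ := hGc.enorm.measurable
  have hFm : Measurable fun z ↦ ‖F z‖ₑ := hFc.enorm.measurable
  rw [← lintegral_const_mul' _ _ ENNReal.ofReal_ne_top]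
  refine (lintegral_mono hpt).trans ?_
  rw [lintegral_const_mul' _ _ ENNReal.ofReal_ne_top]
  refine mul_le_mul_right ?_ _
  have hGFm : Measurable fun z ↦ ‖G z‖ₑ * ‖F z‖ₑ := hGm.mul hFm
  rw [lintegral_add_right _ hGFm]
  refine add_le_add ?_ ?_
  · have : ∫⁻ z, A * A₀ * (Metric.ball (0 : Space d) 1).indicator radialWeight z = A * A₀ * V := by
      rw [lintegral_const_mul' _ _ (by finiteness), lintegral_indicator measurableSet_ball]
    rw [← this]
    refine lintegral_mono_ae ?_
    filter_upwards [hGA, hFA] with z h1 h2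
    gcongr
  · refine le_trans ?_ (add_le_add hGL hFL)
    rw [← lintegral_add_right _ (hFm.pow_const 2)]
    refine lintegral_mono fun z ↦ ?_
    rcases le_total ‖G z‖ₑ ‖F z‖ₑ with h | h
    · exact (mul_le_mul_left h _).trans (by rw [← sq]; exact le_add_left le_rfl)
    · exact (mul_le_mul_right h _).trans (by rw [← sq]; exact le_add_right le_rfl)

lemma lintegral_comp_smul_eq {σ : ℝ} (hσ : 0 < σ) {f : Space d → ℝ≥0∞} (hf : Measurable f) :
    ∫⁻ x, f (σ • x) = ENNReal.ofReal ((σ ^ d)⁻¹) * ∫⁻ x, f x := by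
  have h := Measure.map_addHaar_smul (volume : Measure (Space d)) hσ.ne'
  rw [← lintegral_map hf (measurable_const_smul σ), h, lintegral_smul_measure]
  simp [abs_of_pos hσ]

lemma radialWeight_inv_smul {σ : ℝ} (hσ : 0 < σ) (z : Space d) :
    radialWeight (σ⁻¹ • z) = ENNReal.ofReal (σ ^ (d - 1)) * radialWeight z := by
  rw [radialWeight, radialWeight, ← ENNReal.ofReal_mul (by positivity), norm_smul, mul_pow,
    mul_inv, Real.norm_of_nonneg (by positivity), inv_pow, inv_inv]

section Dilation

variable {k h : 𝓢(Space d, ℂ)} {c σ : ℝ}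

lemma fourierInv_dilation (hσ : 0 < σ) (hk : ∀ ξ, k ξ = c * h (σ⁻¹ • ξ)) (z : Space d) :
    𝓕⁻ k z = ((c * σ ^ d : ℝ) : ℂ) * 𝓕⁻ h (σ • z) := by
  rw [SchwartzMap.fourierInv_coe, SchwartzMap.fourierInv_coe, Real.fourierInv_eq',
    Real.fourierInv_eq']
  have h1 := Measure.integral_comp_smul (volume : Measure (Space d)) (fun v ↦
    Complex.exp ((↑(2 * Real.pi * inner ℝ v (σ • z)) * Complex.I)) • h v) σ⁻¹
  have h2 : ∀ v : Space d, Complex.exp ((↑(2 * Real.pi * inner ℝ v z) * Complex.I)) • k v =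
      (c : ℂ) * (Complex.exp ((↑(2 * Real.pi * inner ℝ (σ⁻¹ • v) (σ • z)) * Complex.I)) •
        h (σ⁻¹ • v)) := fun v ↦ by
    rw [hk, inner_smul_left, inner_smul_right]
    simp only [conj_trivial, smul_eq_mul]
    rw [inv_mul_cancel_left₀ hσ.ne']
    ring
  simp_rw [h2]
  rw [integral_const_mul, h1]
  simp [abs_of_pos hσ]
  ring

lemma lintegral_sq_dilation (hσ : 0 < σ) (hk : ∀ ξ, k ξ = c * h (σ⁻¹ • ξ)) :
    ∫⁻ ξ, ‖k ξ‖ₑ ^ 2 = ENNReal.ofReal (c ^ 2 * σ ^ d) * ∫⁻ ξ, ‖h ξ‖ₑ ^ 2 := by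
  have hm : Measurable fun ξ ↦ ‖h ξ‖ₑ ^ 2 := (h.continuous.enorm.measurable).pow_const 2
  have h1 := lintegral_comp_smul_eq (inv_pos.2 hσ) hm
  have h2 : ∀ ξ, ‖k ξ‖ₑ ^ 2 = ENNReal.ofReal (c ^ 2) * ‖h (σ⁻¹ • ξ)‖ₑ ^ 2 := fun ξ ↦ by
    rw [hk, enorm_mul, mul_pow, ← sq_abs c, ENNReal.ofReal_pow (abs_nonneg c)]
    congr 2
    rw [← ofReal_norm, Complex.norm_real, Real.norm_eq_abs]
  simp_rw [h2]
  rw [lintegral_const_mul' _ _ ENNReal.ofReal_ne_top, h1, ← mul_assoc,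
    ← ENNReal.ofReal_mul (by positivity)]
  simp

lemma lintegral_radialWeight_dilation (hσ : 0 < σ) (hk : ∀ ξ, k ξ = c * h (σ⁻¹ • ξ)) :
    ∫⁻ z, ‖𝓕⁻ k z‖ₑ ^ 2 * radialWeight z =
      ENNReal.ofReal (c ^ 2 * σ ^ d * σ ^ (d - 1)) *
        ∫⁻ z, ‖𝓕⁻ h z‖ₑ ^ 2 * radialWeight z := by
  have hm : Measurable fun z ↦ ‖𝓕⁻ h z‖ₑ ^ 2 * radialWeight (σ⁻¹ • z) :=
    ((SchwartzMap.continuous _).enorm.measurable.pow_const 2).mul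
      (measurable_radialWeight.comp (measurable_const_smul _))
  have h1 := lintegral_comp_smul_eq hσ hm
  have h2 : ∀ z, ‖𝓕⁻ k z‖ₑ ^ 2 * radialWeight z = ENNReal.ofReal ((c * σ ^ d) ^ 2) *
      (‖𝓕⁻ h (σ • z)‖ₑ ^ 2 * radialWeight (σ⁻¹ • σ • z)) := fun z ↦ by
    rw [fourierInv_dilation hσ hk, enorm_mul, mul_pow, ← sq_abs (c * _),
      ENNReal.ofReal_pow (abs_nonneg _), mul_assoc, inv_smul_smul₀ hσ.ne']
    congr 2
    rw [← ofReal_norm, Complex.norm_real, Real.norm_eq_abs]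
  simp_rw [h2]
  rw [lintegral_const_mul' _ _ ENNReal.ofReal_ne_top, h1, ← mul_assoc,
    ← ENNReal.ofReal_mul (by positivity)]
  simp_rw [radialWeight_inv_smul hσ]
  have h3 : ∀ z, ‖𝓕⁻ h z‖ₑ ^ 2 * (ENNReal.ofReal (σ ^ (d - 1)) * radialWeight z) =
      ENNReal.ofReal (σ ^ (d - 1)) * (‖𝓕⁻ h z‖ₑ ^ 2 * radialWeight z) := fun z ↦ by ring
  simp_rw [h3]
  rw [lintegral_const_mul' _ _ ENNReal.ofReal_ne_top, ← mul_assoc,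
    ← ENNReal.ofReal_mul (by positivity)]
  congr 2
  field_simp

end Dilation

/-! ### The dyadic kernels -/

/-- A radial bump in the angular frequency `2πξ`: it is `1` for `|2πξ| ≤ 2` and vanishes for
`|2πξ| ≥ 4`. -/
def bump (ξ : Space d) : ℝ := Real.smoothTransition ((16 - ‖(2 * Real.pi) • ξ‖ ^ 2) / 12)

lemma contDiff_bump : ContDiff ℝ ∞ (bump : Space d → ℝ) :=
  Real.smoothTransition.contDiff.comp
    ((contDiff_const.sub ((contDiff_norm_sq ℝ).comp (contDiff_id.const_smul _))).div_const _)

lemma contDiff_bump_smul (c : ℝ) : ContDiff ℝ ∞ fun ξ : Space d ↦ bump (c • ξ) :=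
  contDiff_bump.comp (contDiff_id.const_smul c)

lemma bump_eq_one {ξ : Space d} (h : ‖(2 * Real.pi) • ξ‖ ≤ 2) : bump ξ = 1 :=
  Real.smoothTransition.one_of_one_le (by nlinarith [norm_nonneg ((2 * Real.pi) • ξ)])

lemma bump_eq_zero {ξ : Space d} (h : 4 ≤ ‖(2 * Real.pi) • ξ‖) : bump ξ = 0 :=
  Real.smoothTransition.zero_of_nonpos (by nlinarith)

lemma bump_congr {ξ η : Space d} (h : ‖ξ‖ = ‖η‖) : bump ξ = bump η := by
  simp [bump, norm_smul, h]

lemma norm_smul_two_pi_smul {c : ℝ} (hc : 0 ≤ c) (ξ : Space d) :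
    ‖(2 * Real.pi) • c • ξ‖ = c * ‖(2 * Real.pi) • ξ‖ := by
  rw [smul_comm, norm_smul, Real.norm_of_nonneg hc]

lemma hasCompactSupport_bump_smul {c : ℝ} (hc : 0 < c) :
    HasCompactSupport fun ξ : Space d ↦ bump (c • ξ) := by
  refine HasCompactSupport.intro (isCompact_closedBall 0 (4 / c)) fun ξ hξ ↦ bump_eq_zero ?_
  have h : 4 / c < ‖ξ‖ := by simpa using hξ
  rw [norm_smul_two_pi_smul hc.le, norm_smul, Real.norm_of_nonneg (by positivity)]
  rw [div_lt_iff₀ hc] at h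
  nlinarith [Real.pi_gt_three, norm_nonneg ξ]

/-- Radial cut-offs equal to `1` on the support of the Littlewood-Paley symbols. -/
def kernelCutoff : ℕ → Space d → ℝ
  | 0, ξ => bump ξ
  | j + 1, ξ => bump (((2 : ℝ) ^ (j + 1))⁻¹ • ξ) - bump ((8 : ℝ) • ((2 : ℝ) ^ (j + 1))⁻¹ • ξ)

lemma contDiff_kernelCutoff (j : ℕ) : ContDiff ℝ ∞ (kernelCutoff j : Space d → ℝ) := by
  cases j with
  | zero => exact contDiff_bump
  | succ j =>
    refine (contDiff_bump_smul _).sub ?_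
    simp_rw [smul_smul]
    exact contDiff_bump_smul _

lemma hasCompactSupport_kernelCutoff (j : ℕ) :
    HasCompactSupport (kernelCutoff j : Space d → ℝ) := by
  cases j with
  | zero => simpa [kernelCutoff] using! hasCompactSupport_bump_smul (d := d) one_pos
  | succ j =>
    refine (hasCompactSupport_bump_smul (by positivity)).sub ?_
    simp_rw [smul_smul]
    exact hasCompactSupport_bump_smul (by positivity)

lemma kernelCutoff_congr (j : ℕ) {ξ η : Space d} (h : ‖ξ‖ = ‖η‖) :
    kernelCutoff j ξ = kernelCutoff j η := by
  cases j with
  | zero => exact bump_congr h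
  | succ j =>
    simp only [kernelCutoff]
    congr 1 <;> exact bump_congr (by simp [norm_smul, h])

lemma dyadicSymbol_mul_kernelCutoff {ψ : Space d → ℝ} (hψ : IsCutoff ψ) (j : ℕ) (ξ : Space d) :
    dyadicSymbol ψ j ((2 * Real.pi) • ξ) * kernelCutoff j ξ =
      dyadicSymbol ψ j ((2 * Real.pi) • ξ) := by
  cases j with
  | zero =>
    simp only [dyadicSymbol, kernelCutoff]
    by_cases h : ‖(2 * Real.pi) • ξ‖ ≤ 2
    · rw [bump_eq_one h, mul_one]
    · rw [hψ.eq_zero _ (not_le.1 h).le, zero_mul]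
  | succ j =>
    simp only [dyadicSymbol, kernelCutoff]
    set r := ‖(2 * Real.pi) • ξ‖
    have hp : (0 : ℝ) < 2 ^ j := by positivity
    have e1 : ‖((2 : ℝ) ^ (j + 1))⁻¹ • (2 * Real.pi) • ξ‖ = r / (2 ^ j * 2) := by
      rw [norm_smul, Real.norm_of_nonneg (by positivity), pow_succ]; field_simp; rfl
    have e2 : ‖((2 : ℝ) ^ j)⁻¹ • (2 * Real.pi) • ξ‖ = r / 2 ^ j := by
      rw [norm_smul, Real.norm_of_nonneg (by positivity)]; field_simp; rfl
    have e3 : ‖(2 * Real.pi) • ((2 : ℝ) ^ (j + 1))⁻¹ • ξ‖ = r / (2 ^ j * 2) := by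
      rw [smul_comm, e1]
    have e4 : ‖(2 * Real.pi) • (8 : ℝ) • ((2 : ℝ) ^ (j + 1))⁻¹ • ξ‖ = 8 * (r / (2 ^ j * 2)) := by
      rw [norm_smul_two_pi_smul (by norm_num), e3]
    by_cases h1 : r ≤ 2 ^ j
    · rw [hψ.eq_one _ (by rw [e1, div_le_iff₀ (by positivity)]; linarith),
        hψ.eq_one _ (by rw [e2, div_le_iff₀ hp]; linarith)]
      simp
    by_cases h2 : r ≤ 4 * 2 ^ j
    · rw [bump_eq_one (by rw [e3, div_le_iff₀ (by positivity)]; linarith),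
        bump_eq_zero (by rw [e4]; rw [not_le] at h1; field_simp; linarith)]
      simp
    · rw [not_le] at h2
      rw [hψ.eq_zero _ (by rw [e1, le_div_iff₀ (by positivity)]; linarith),
        hψ.eq_zero _ (by rw [e2, le_div_iff₀ hp]; linarith)]
      simp

/-- The symbol `e^{it⟨2πξ⟩} ⟨2πξ⟩^{-α} m(ξ)`, with `m` a smooth cut-off. -/
def flowSymbol (α t : ℝ) {m : Space d → ℝ} (hm : ContDiff ℝ ∞ m) (hc : HasCompactSupport m) :
    𝓢(Space d, ℂ) :=
  HasCompactSupport.toSchwartzMap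
    (f := fun ξ ↦ Complex.exp (Complex.I * ((t * bracket ((2 * Real.pi) • ξ) : ℝ) : ℂ)) *
      (((bracket ((2 * Real.pi) • ξ) ^ (-α) : ℝ) : ℂ) * (m ξ : ℂ)))
    (((hc.comp_left (g := Complex.ofReal) rfl).mul_left).mul_left)
    ((hasTemperateGrowth_propagator t _).1.mul
      ((hasTemperateGrowth_bracket_rpow (-α) _).1.mul (Complex.ofRealCLM.contDiff.comp hm)))

lemma flowSymbol_apply (α t : ℝ) {m : Space d → ℝ} (hm : ContDiff ℝ ∞ m)
    (hc : HasCompactSupport m) (ξ : Space d) : flowSymbol α t hm hc ξ =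
      Complex.exp (Complex.I * ((t * bracket ((2 * Real.pi) • ξ) : ℝ) : ℂ)) *
      (((bracket ((2 * Real.pi) • ξ) ^ (-α) : ℝ) : ℂ) * (m ξ : ℂ)) := rfl

/-- The symbol of the dyadic piece of `e^{it⟨∇⟩}⟨∇⟩^{-α}` at the frequency `2^j`. -/
def kernelSymbol (α t : ℝ) (j : ℕ) : 𝓢(Space d, ℂ) :=
  flowSymbol α t (contDiff_kernelCutoff j) (hasCompactSupport_kernelCutoff j)

/-- The difference of two dilates of `bump`, as a family that does not depend on the parameter. -/
lemma isAnnular_bump_sub {c : ℝ} (hc : 1 ≤ c) : IsAnnular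
    (fun p : ℝ × Space d ↦ ((bump p.2 - bump (c • p.2) : ℝ) : ℂ)) := by
  have hpi := Real.pi_pos
  refine ⟨Complex.ofRealCLM.contDiff.comp ((contDiff_bump.comp contDiff_snd).sub
    ((contDiff_bump_smul c).comp contDiff_snd)), 2 / (c * (2 * Real.pi)), by positivity,
    4 / (2 * Real.pi), fun p hp ↦ ?_⟩
  have hn : ‖(2 * Real.pi) • p.2‖ = 2 * Real.pi * ‖p.2‖ := by
    rw [norm_smul, Real.norm_of_nonneg (by positivity)]
  have hn' := norm_smul_two_pi_smul (zero_le_one.trans hc) p.2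
  by_contra h
  apply hp
  rw [not_and_or, not_le, not_le, lt_div_iff₀ (by positivity), div_lt_iff₀ (by positivity)] at h
  have h0 := norm_nonneg ((2 * Real.pi) • p.2)
  rcases h with h | h
  · have h1 : ‖(2 * Real.pi) • c • p.2‖ ≤ 2 := by rw [hn', hn]; linarith
    rw [bump_eq_one h1, bump_eq_one (by nlinarith)]
    simp
  · have h1 : 4 ≤ ‖(2 * Real.pi) • p.2‖ := by rw [hn]; linarith
    rw [bump_eq_zero h1, bump_eq_zero (by nlinarith)]
    simp

lemma contDiffAt_norm_sq_snd (p : ℝ × Space d) :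
    ContDiffAt ℝ ∞ (fun p : ℝ × Space d ↦ ‖(2 * Real.pi) • p.2‖ ^ 2) p :=
  ((contDiff_norm_sq ℝ).comp (contDiff_snd.const_smul _)).contDiffAt

lemma norm_two_pi_smul_pos {η : Space d} (hη : η ≠ 0) : 0 < ‖(2 * Real.pi) • η‖ :=
  norm_pos_iff.2 (smul_ne_zero (by positivity) hη)

section HighFrequency

/-- The rescaled symbols at high frequency `σ = 1/ε`: `⟨2πση⟩ = σ (ε² + |2πη|²)^{1/2}`. -/
def highFamily (α : ℝ) (p : ℝ × Space d) : ℂ :=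
  (((p.1 ^ 2 + ‖(2 * Real.pi) • p.2‖ ^ 2) ^ (-α / 2) : ℝ) : ℂ) *
    ((bump p.2 - bump ((8 : ℝ) • p.2) : ℝ) : ℂ)

lemma isAnnular_highFamily (α : ℝ) : IsAnnular (highFamily α : ℝ × Space d → ℂ) := by
  refine (isAnnular_bump_sub (c := 8) (by norm_num)).mul fun p hp ↦ ?_
  have h0 := norm_two_pi_smul_pos hp
  refine Complex.ofRealCLM.contDiff.contDiffAt.comp p (ContDiffAt.rpow_const_of_ne
    ((contDiffAt_fst.pow 2).add (contDiffAt_norm_sq_snd p)) (by positivity))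

/-- The reciprocal radial derivative of the rescaled phase at high frequency. -/
def highGain (p : ℝ × Space d) : ℝ :=
  √(p.1 ^ 2 + ‖(2 * Real.pi) • p.2‖ ^ 2) / ‖(2 * Real.pi) • p.2‖ ^ 2

lemma contDiffAt_highGain (p : ℝ × Space d) (hp : p.2 ≠ 0) :
    ContDiffAt ℝ ∞ (highGain : ℝ × Space d → ℝ) p := by
  have h0 := norm_two_pi_smul_pos hp
  exact (((contDiffAt_fst.pow 2).add (contDiffAt_norm_sq_snd p)).sqrt (by positivity)).div
    (contDiffAt_norm_sq_snd p) (by positivity)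

lemma bracket_high {σ : ℝ} (hσ : 0 < σ) (η : Space d) :
    bracket ((2 * Real.pi * σ) • η) = σ * √(σ⁻¹ ^ 2 + ‖(2 * Real.pi) • η‖ ^ 2) := by
  rw [bracket, mul_smul, norm_smul_two_pi_smul hσ.le, ← Real.sqrt_sq hσ.le,
    ← Real.sqrt_mul (by positivity), Real.sqrt_sq hσ.le]
  congr 1
  field_simp

/-- The phase `t⟨2πση⟩` has the Euler derivative `τ / highGain` with `τ = tσ`: at high frequency it
grows linearly. -/
lemma highGain_relation {σ : ℝ} (hσ : 0 < σ) (t : ℝ) (η : Space d) (hη : η ≠ 0) :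
    t * (2 * Real.pi * σ) ^ 2 * ‖η‖ ^ 2 * highGain (σ⁻¹, η) =
      (t * σ) * bracket ((2 * Real.pi * σ) • η) := by
  have h0 := norm_two_pi_smul_pos hη
  have h1 : ‖(2 * Real.pi) • η‖ ^ 2 = (2 * Real.pi) ^ 2 * ‖η‖ ^ 2 := by
    rw [norm_smul, mul_pow, Real.norm_of_nonneg (by positivity)]
  have h2 : t * (2 * Real.pi * σ) ^ 2 * ‖η‖ ^ 2 = t * σ ^ 2 * ‖(2 * Real.pi) • η‖ ^ 2 := by
    rw [h1]; ring
  rw [bracket_high hσ, highGain, h2]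
  field_simp

lemma kernelSymbol_succ (α t : ℝ) (j : ℕ) (ξ : Space d) :
    kernelSymbol α t (j + 1) ξ = (((2 ^ (j + 1) : ℝ) ^ (-α) : ℝ) : ℂ) *
      oscSymbol (isAnnular_highFamily α) (2 ^ (j + 1))⁻¹ (2 ^ (j + 1)) t
        (((2 : ℝ) ^ (j + 1))⁻¹ • ξ) := by
  set σ : ℝ := 2 ^ (j + 1)
  have hσ : 0 < σ := by positivity
  have h1 : (2 * Real.pi * σ) • σ⁻¹ • ξ = (2 * Real.pi) • ξ := by
    rw [smul_smul, mul_assoc, mul_inv_cancel₀ hσ.ne', mul_one]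
  have h2 := bracket_high hσ (σ⁻¹ • ξ)
  rw [h1] at h2
  rw [kernelSymbol, flowSymbol_apply, oscSymbol_apply, h1, kernelCutoff, highFamily]
  rw [show (bracket ((2 * Real.pi) • ξ)) ^ (-α) = σ ^ (-α) *
    (σ⁻¹ ^ 2 + ‖(2 * Real.pi) • σ⁻¹ • ξ‖ ^ 2) ^ (-α / 2) by
      rw [h2, Real.mul_rpow hσ.le (by positivity), Real.sqrt_eq_rpow,
        ← Real.rpow_mul (by positivity)]
      congr 2
      ring]
  push_cast
  ring

end HighFrequency

section LowFrequency

/-- The rescaled symbols at low frequency `σ = ε`. -/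
def lowFamily (α : ℝ) (p : ℝ × Space d) : ℂ :=
  (((1 + p.1 ^ 2 * ‖(2 * Real.pi) • p.2‖ ^ 2) ^ (-α / 2) : ℝ) : ℂ) *
    ((bump p.2 - bump ((2 : ℝ) • p.2) : ℝ) : ℂ)

lemma isAnnular_lowFamily (α : ℝ) : IsAnnular (lowFamily α : ℝ × Space d → ℂ) := by
  refine (isAnnular_bump_sub (c := 2) (by norm_num)).mul fun p hp ↦ ?_
  refine Complex.ofRealCLM.contDiff.contDiffAt.comp p (ContDiffAt.rpow_const_of_ne
    (contDiffAt_const.add ((contDiffAt_fst.pow 2).mul (contDiffAt_norm_sq_snd p))) (by positivity))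

/-- The reciprocal radial derivative of the rescaled phase at low frequency. -/
def lowGain (p : ℝ × Space d) : ℝ :=
  √(1 + p.1 ^ 2 * ‖(2 * Real.pi) • p.2‖ ^ 2) / ‖(2 * Real.pi) • p.2‖ ^ 2

lemma contDiffAt_lowGain (p : ℝ × Space d) (hp : p.2 ≠ 0) :
    ContDiffAt ℝ ∞ (lowGain : ℝ × Space d → ℝ) p := by
  have h0 := norm_two_pi_smul_pos hp
  exact ((contDiffAt_const.add ((contDiffAt_fst.pow 2).mul (contDiffAt_norm_sq_snd p))).sqrt
    (by positivity)).div (contDiffAt_norm_sq_snd p) (by positivity)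

lemma bracket_low {ε : ℝ} (hε : 0 < ε) (η : Space d) :
    bracket ((2 * Real.pi * ε) • η) = √(1 + ε ^ 2 * ‖(2 * Real.pi) • η‖ ^ 2) := by
  rw [bracket, mul_smul, norm_smul_two_pi_smul hε.le, mul_pow]

/-- The phase `t⟨2πεη⟩` has the Euler derivative `τ / lowGain` with `τ = tε²`: at low frequency it
is quadratic up to a constant. -/
lemma lowGain_relation {ε : ℝ} (hε : 0 < ε) (t : ℝ) (η : Space d) (hη : η ≠ 0) :
    t * (2 * Real.pi * ε) ^ 2 * ‖η‖ ^ 2 * lowGain (ε, η) =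
      (t * ε ^ 2) * bracket ((2 * Real.pi * ε) • η) := by
  have h0 := norm_two_pi_smul_pos hη
  have h1 : ‖(2 * Real.pi) • η‖ ^ 2 = (2 * Real.pi) ^ 2 * ‖η‖ ^ 2 := by
    rw [norm_smul, mul_pow, Real.norm_of_nonneg (by positivity)]
  have h2 : t * (2 * Real.pi * ε) ^ 2 * ‖η‖ ^ 2 = t * ε ^ 2 * ‖(2 * Real.pi) • η‖ ^ 2 := by
    rw [h1]; ring
  rw [bracket_low hε, lowGain, h2]
  field_simp

lemma contDiff_bump_sub_bump (c c' : ℝ) :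
    ContDiff ℝ ∞ fun ξ : Space d ↦ bump (c • ξ) - bump (c' • ξ) :=
  (contDiff_bump_smul c).sub (contDiff_bump_smul c')

lemma hasCompactSupport_bump_sub_bump {c c' : ℝ} (hc : 0 < c) (hc' : 0 < c') :
    HasCompactSupport fun ξ : Space d ↦ bump (c • ξ) - bump (c' • ξ) :=
  (hasCompactSupport_bump_smul hc).sub (hasCompactSupport_bump_smul hc')

/-- The piece of `kernelSymbol α t 0` at the low frequency `2^{-k}`. -/
def lowSymbol (α t : ℝ) (k : ℕ) : 𝓢(Space d, ℂ) :=
  flowSymbol α t (contDiff_bump_sub_bump (2 ^ k) (2 ^ (k + 1)))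
    (hasCompactSupport_bump_sub_bump (by positivity) (by positivity))

/-- What is left of `kernelSymbol α t 0` below the frequency `2^{-n}`. -/
def lowRemainder (α t : ℝ) (n : ℕ) : 𝓢(Space d, ℂ) :=
  flowSymbol α t (contDiff_bump_smul (2 ^ n)) (hasCompactSupport_bump_smul (by positivity))

lemma lowSymbol_eq (α t : ℝ) (k : ℕ) (ξ : Space d) :
    lowSymbol α t k ξ = ((1 : ℝ) : ℂ) *
      oscSymbol (isAnnular_lowFamily α) (2 ^ k)⁻¹ (2 ^ k)⁻¹ t ((((2 : ℝ) ^ k)⁻¹)⁻¹ • ξ) := by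
  set ε : ℝ := (2 ^ k)⁻¹
  have hε : 0 < ε := by positivity
  have h1 : (2 * Real.pi * ε) • ε⁻¹ • ξ = (2 * Real.pi) • ξ := by
    rw [smul_smul, mul_assoc, mul_inv_cancel₀ hε.ne', mul_one]
  have h2 := bracket_low hε (ε⁻¹ • ξ)
  rw [h1] at h2
  have h3 : (2 : ℝ) ^ k = ε⁻¹ := by simp [ε]
  have h4 : (2 : ℝ) ^ (k + 1) = 2 * ε⁻¹ := by rw [pow_succ, h3, mul_comm]
  rw [lowSymbol, flowSymbol_apply, oscSymbol_apply, h1, lowFamily]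
  rw [show (bracket ((2 * Real.pi) • ξ)) ^ (-α) =
    (1 + ε ^ 2 * ‖(2 * Real.pi) • ε⁻¹ • ξ‖ ^ 2) ^ (-α / 2) by
      rw [h2, Real.sqrt_eq_rpow, ← Real.rpow_mul (by positivity)]
      congr 1
      ring, h3, h4]
  simp [mul_smul]

lemma kernelSymbol_zero_eq (α t : ℝ) (n : ℕ) : (kernelSymbol α t 0 : 𝓢(Space d, ℂ)) =
    ∑ k ∈ Finset.range n, lowSymbol α t k + lowRemainder α t n := by
  induction n with
  | zero =>
    ext ξ
    simp [kernelSymbol, lowRemainder, flowSymbol_apply, kernelCutoff]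
  | succ n ih =>
    rw [ih, Finset.sum_range_succ, add_assoc]
    congr 1
    ext ξ
    simp only [lowRemainder, lowSymbol, add_apply, flowSymbol_apply]
    push_cast
    ring

lemma norm_flowSymbol_le {α : ℝ} (hα : 0 ≤ α) (t : ℝ) {m : Space d → ℝ} (hm : ContDiff ℝ ∞ m)
    (hc : HasCompactSupport m) (ξ : Space d) : ‖flowSymbol α t hm hc ξ‖ ≤ |m ξ| := by
  rw [flowSymbol_apply, norm_mul, norm_mul, mul_comm Complex.I, Complex.norm_exp_ofReal_mul_I,
    one_mul, Complex.norm_real, Complex.norm_real, Real.norm_eq_abs, Real.norm_eq_abs]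
  refine mul_le_of_le_one_left (abs_nonneg _) ?_
  rw [abs_of_nonneg (Real.rpow_nonneg (bracket_pos _).le _)]
  exact Real.rpow_le_one_of_one_le_of_nonpos (one_le_bracket _) (by linarith)

lemma tendsto_fourierInv_lowRemainder (hd : 1 ≤ d) {α : ℝ} (hα : 0 ≤ α) (t : ℝ) (z : Space d) :
    Filter.Tendsto (fun n ↦ 𝓕⁻ (lowRemainder α t n) z) Filter.atTop (nhds 0) := by
  set I := ∫ ξ : Space d, |bump ξ|
  have h1 : ∀ n, ‖𝓕⁻ (lowRemainder α t n) z‖ ≤ ((2 : ℝ)⁻¹ ^ d) ^ n * I := fun n ↦ by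
    have hb : Integrable (fun ξ : Space d ↦ |bump ((2 : ℝ) ^ n • ξ)|) :=
      ((contDiff_bump_smul _).continuous.integrable_of_hasCompactSupport
        (hasCompactSupport_bump_smul (by positivity))).abs
    calc ‖𝓕⁻ (lowRemainder α t n) z‖ ≤ ‖(lowRemainder α t n).toLp 1‖ := by
          rw [SchwartzMap.fourierInv_apply_eq]
          exact SchwartzMap.norm_fourier_apply_le_toLp_one _ _
      _ = ∫ ξ, ‖lowRemainder α t n ξ‖ := SchwartzMap.norm_toLp_one
      _ ≤ ∫ ξ, |bump ((2 : ℝ) ^ n • ξ)| := by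
          refine integral_mono (SchwartzMap.integrable _).norm hb fun ξ ↦ ?_
          exact norm_flowSymbol_le hα t _ _ ξ
      _ = _ := by
          rw [Measure.integral_comp_smul (volume : Measure (Space d)) (fun ξ ↦ |bump ξ|)]
          simp [I, ← pow_mul, mul_comm]
  have h2 : Filter.Tendsto (fun n ↦ ((2 : ℝ)⁻¹ ^ d) ^ n * I) Filter.atTop (nhds (0 * I)) :=
    (tendsto_pow_atTop_nhds_zero_of_lt_one (by positivity)
      (pow_lt_one₀ (by positivity) (by norm_num) (by omega))).mul_const I
  rw [zero_mul] at h2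
  exact squeeze_zero_norm h1 h2

end LowFrequency

lemma lintegral_enorm_sq_fourierInv (k : 𝓢(Space d, ℂ)) :
    ∫⁻ z, ‖𝓕⁻ k z‖ₑ ^ 2 = ∫⁻ ξ, ‖k ξ‖ₑ ^ 2 := by
  rw [← eLpNorm_two_sq, ← eLpNorm_two_sq, eLpNorm_fourierInv]

lemma lintegral_enorm_sq_fourier (k : 𝓢(Space d, ℂ)) :
    ∫⁻ ξ, ‖𝓕 k ξ‖ₑ ^ 2 = ∫⁻ z, ‖k z‖ₑ ^ 2 := by
  rw [← eLpNorm_two_sq, ← eLpNorm_two_sq, eLpNorm_fourier]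

lemma inv_two_pow_mem_Icc (k : ℕ) : ((2 : ℝ) ^ k)⁻¹ ∈ Set.Icc (0 : ℝ) 1 :=
  ⟨by positivity, inv_le_one_of_one_le₀ (one_le_pow₀ one_le_two)⟩

/-- `L^2` bound of the dyadic kernels, uniform in time. -/
lemma exists_lintegral_kernel_le {α : ℝ} (hα : 0 ≤ α) :
    ∃ M : ℝ≥0∞, M ≠ ⊤ ∧ ∀ (t : ℝ) (j : ℕ),
      ∫⁻ z : Space d, ‖𝓕⁻ (kernelSymbol α t j) z‖ₑ ^ 2 ≤
        M * ENNReal.ofReal (((2 : ℝ) ^ j) ^ ((d : ℝ) - 2 * α)) := by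
  obtain ⟨A, hA, hbA⟩ := (isAnnular_highFamily (d := d) α).exists_eLpNorm_le 2
  have hB : MemLp (fun ξ : Space d ↦ |bump ξ|) 2 volume :=
    contDiff_bump.continuous.abs.memLp_of_hasCompactSupport
      (by simpa using! (hasCompactSupport_bump_smul (d := d) one_pos).norm)
  refine ⟨eLpNorm (fun ξ : Space d ↦ |bump ξ|) 2 volume ^ 2 + A ^ 2,
    ENNReal.add_ne_top.2 ⟨ENNReal.pow_ne_top hB.eLpNorm_ne_top, ENNReal.pow_ne_top hA⟩,
    fun t j ↦ ?_⟩
  rw [lintegral_enorm_sq_fourierInv]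
  cases j with
  | zero =>
    rw [← eLpNorm_two_sq]
    simp only [pow_zero, Real.one_rpow, ENNReal.ofReal_one, mul_one]
    refine le_add_right (pow_le_pow_left' (eLpNorm_mono_real fun ξ ↦ ?_) 2)
    exact norm_flowSymbol_le hα t _ _ ξ
  | succ j =>
    have hσ : (0 : ℝ) < 2 ^ (j + 1) := by positivity
    rw [lintegral_sq_dilation hσ (kernelSymbol_succ α t j), mul_comm]
    refine mul_le_mul' (le_add_left ?_) (ENNReal.ofReal_le_ofReal (le_of_eq ?_))
    · rw [← eLpNorm_two_sq]
      refine pow_le_pow_left' ?_ 2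
      refine le_trans (le_of_eq ?_) (hbA _ (inv_two_pow_mem_Icc (j + 1)))
      exact eLpNorm_congr_norm_ae (ae_of_all _ fun η ↦ norm_oscSymbol _ _ _ t η)
    · rw [← Real.rpow_natCast _ d, ← Real.rpow_natCast _ 2, ← Real.rpow_mul hσ.le,
        ← Real.rpow_add hσ]
      congr 1
      push_cast
      ring

/-- Decay in time of the high-frequency kernels in `L^2(|z|^{1 - d} dz)`. -/
lemma exists_lintegral_radialWeight_kernel_succ_le (hd : 1 ≤ d) (α : ℝ) :
    ∃ M : ℝ≥0∞, M ≠ ⊤ ∧ ∀ (t : ℝ) (j : ℕ), ENNReal.ofReal (|t| ^ (d - 1)) *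
      ∫⁻ z : Space d, ‖𝓕⁻ (kernelSymbol α t (j + 1)) z‖ₑ ^ 2 * radialWeight z ≤
        M * ENNReal.ofReal (((2 : ℝ) ^ (j + 1)) ^ ((d : ℝ) - 2 * α)) := by
  obtain ⟨M, hM, h⟩ := exists_lintegral_radialWeight_oscSymbol_le hd contDiffAt_highGain
    (isAnnular_highFamily (d := d) α)
  refine ⟨M, hM, fun t j ↦ ?_⟩
  set σ : ℝ := 2 ^ (j + 1)
  have hσ : 0 < σ := by positivity
  have h1 := h σ⁻¹ (inv_two_pow_mem_Icc (j + 1)) σ t (t * σ) (highGain_relation hσ t)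
  rw [lintegral_radialWeight_dilation hσ (kernelSymbol_succ α t j), ← mul_assoc,
    ← ENNReal.ofReal_mul (by positivity)]
  have h2 : |t| ^ (d - 1) * ((σ ^ (-α)) ^ 2 * σ ^ d * σ ^ (d - 1)) =
      σ ^ ((d : ℝ) - 2 * α) * |t * σ| ^ (d - 1) := by
    have : (σ ^ (-α)) ^ 2 * σ ^ d = σ ^ ((d : ℝ) - 2 * α) := by
      rw [← Real.rpow_natCast _ d, ← Real.rpow_natCast _ 2, ← Real.rpow_mul hσ.le,
        ← Real.rpow_add hσ]
      congr 1
      push_cast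
      ring
    rw [this, abs_mul, abs_of_pos hσ, mul_pow]
    ring
  rw [h2, ENNReal.ofReal_mul (by positivity), mul_assoc, mul_comm]
  exact mul_le_mul_left h1 _

lemma eLpNorm_withDensity_radialWeight_sq {f : Space d → ℂ} (hf : Continuous f) :
    eLpNorm f 2 (volume.withDensity radialWeight) ^ 2 = ∫⁻ z, ‖f z‖ₑ ^ 2 * radialWeight z := by
  rw [eLpNorm_two_sq, lintegral_withDensity_eq_lintegral_mul _ measurable_radialWeight
    (hf.enorm.measurable.pow_const 2)]
  exact lintegral_congr fun z ↦ mul_comm (radialWeight z) _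

/-- Decay in time of the low-frequency kernel in `L^2(|z|^{1 - d} dz)`. The group velocity vanishes
at the frequency `0`, so the kernel is split into pieces at the frequencies `2^{-k}`; their bounds
form a geometric series. -/
lemma exists_lintegral_radialWeight_kernel_zero_le (hd : 1 ≤ d) {α : ℝ} (hα : 0 ≤ α) :
    ∃ M : ℝ≥0∞, M ≠ ⊤ ∧ ∀ t : ℝ, ENNReal.ofReal (|t| ^ (d - 1)) *
      ∫⁻ z : Space d, ‖𝓕⁻ (kernelSymbol α t 0) z‖ₑ ^ 2 * radialWeight z ≤ M := by
  obtain ⟨M, hM, h⟩ := exists_lintegral_radialWeight_oscSymbol_le hd contDiffAt_lowGain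
    (isAnnular_lowFamily (d := d) α)
  set μ : Measure (Space d) := volume.withDensity radialWeight
  set ρ : ℝ := √(1 / 2)
  have hρ : ρ ^ 2 = 1 / 2 := Real.sq_sqrt (by norm_num)
  have hρ0 : 0 ≤ ρ := Real.sqrt_nonneg _
  have hρ1 : ρ < 1 := by nlinarith
  set m := √M.toReal
  have hm : 0 ≤ m := Real.sqrt_nonneg _
  have hmM : ENNReal.ofReal m ^ 2 = M := by
    rw [← ENNReal.ofReal_pow hm, Real.sq_sqrt ENNReal.toReal_nonneg, ENNReal.ofReal_toReal hM]
  refine ⟨ENNReal.ofReal (m * (1 - ρ)⁻¹) ^ 2, by finiteness, fun t ↦ ?_⟩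
  set κ := √(|t| ^ (d - 1))
  have hκ : ENNReal.ofReal κ ^ 2 = ENNReal.ofReal (|t| ^ (d - 1)) := by
    rw [← ENNReal.ofReal_pow (Real.sqrt_nonneg _), Real.sq_sqrt (by positivity)]
  have hc : ∀ k : 𝓢(Space d, ℂ), Continuous (𝓕⁻ k : 𝓢(Space d, ℂ)) := fun k ↦
    SchwartzMap.continuous _
  -- the piece at the frequency `ε = 2^{-k}` is of size `ε^{1/2}`
  have hpiece : ∀ k, ENNReal.ofReal κ * eLpNorm (𝓕⁻ (lowSymbol α t k) : 𝓢(Space d, ℂ)) 2 μ ≤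
      ENNReal.ofReal (m * ρ ^ k) := fun k ↦ by
    set ε : ℝ := (2 ^ k)⁻¹ with hεdef
    have hε : 0 < ε := by positivity
    have h1 := h ε (inv_two_pow_mem_Icc k) ε t (t * ε ^ 2) (lowGain_relation hε t)
    refine (ENNReal.pow_le_pow_left_iff (n := 2) two_ne_zero).1 ?_
    rw [mul_pow, hκ, eLpNorm_withDensity_radialWeight_sq (hc _),
      lintegral_radialWeight_dilation hε (lowSymbol_eq α t k), ← mul_assoc,
      ← ENNReal.ofReal_mul (by positivity)]
    have h2 : |t| ^ (d - 1) * (1 ^ 2 * ε ^ d * ε ^ (d - 1)) = ε * |t * ε ^ 2| ^ (d - 1) := by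
      obtain ⟨e, rfl⟩ : ∃ e, d = e + 1 := ⟨d - 1, by omega⟩
      rw [abs_mul, abs_of_nonneg (by positivity : 0 ≤ ε ^ 2), mul_pow, Nat.add_sub_cancel]
      ring
    have h3 : (m * ρ ^ k) ^ 2 = ε * m ^ 2 := by
      rw [mul_pow, ← pow_mul, mul_comm k, pow_mul, hρ, hεdef, one_div, inv_pow]
      ring
    rw [h2, ENNReal.ofReal_mul hε.le, mul_assoc, ← ENNReal.ofReal_pow (by positivity), h3,
      ENNReal.ofReal_mul hε.le, ENNReal.ofReal_pow hm, hmM]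
    exact mul_le_mul_right h1 _
  set S : ℕ → 𝓢(Space d, ℂ) := fun n ↦ ∑ k ∈ Finset.range n, 𝓕⁻ (lowSymbol α t k)
  have hS : ∀ n, ENNReal.ofReal κ * eLpNorm (S n) 2 μ ≤ ENNReal.ofReal (m * (1 - ρ)⁻¹) := fun n ↦ by
    have h1 : (S n : Space d → ℂ) =
        ∑ k ∈ Finset.range n, ((𝓕⁻ (lowSymbol α t k) : 𝓢(Space d, ℂ)) : Space d → ℂ) := by
      simp only [S, FunLike.coe_sum]
    rw [h1]
    refine (mul_le_mul_right (eLpNorm_sum_le (fun k _ ↦ (hc _).aestronglyMeasurable)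
      one_le_two) _).trans ?_
    rw [Finset.mul_sum]
    refine (Finset.sum_le_sum fun k _ ↦ hpiece k).trans ?_
    rw [← ENNReal.ofReal_sum_of_nonneg fun k _ ↦ by positivity, ← Finset.mul_sum]
    refine ENNReal.ofReal_le_ofReal (mul_le_mul_of_nonneg_left ?_ hm)
    rw [← tsum_geometric_of_lt_one hρ0 hρ1]
    exact (summable_geometric_of_lt_one hρ0 hρ1).sum_le_tsum _ fun k _ ↦ by positivity
  have hlim : ∀ z, Filter.Tendsto (fun n ↦ S n z) Filter.atTop
      (nhds ((𝓕⁻ (kernelSymbol α t 0) : 𝓢(Space d, ℂ)) z)) := fun z ↦ by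
    have h1 : ∀ n, S n z = (𝓕⁻ (kernelSymbol α t 0) : 𝓢(Space d, ℂ)) z -
        (𝓕⁻ (lowRemainder α t n) : 𝓢(Space d, ℂ)) z := fun n ↦ by
      rw [kernelSymbol_zero_eq α t n, FourierTransform.fourierInv_add, add_apply]
      have : (𝓕⁻ (∑ k ∈ Finset.range n, lowSymbol α t k) : 𝓢(Space d, ℂ)) = S n :=
        map_sum (fourierInvCLM ℂ 𝓢(Space d, ℂ)) _ _
      rw [this]
      ring
    simp_rw [h1]
    simpa using (tendsto_const_nhds (x := (𝓕⁻ (kernelSymbol α t 0) : 𝓢(Space d, ℂ)) z)).sub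
      (tendsto_fourierInv_lowRemainder hd hα t z)
  rw [← hκ, ← eLpNorm_withDensity_radialWeight_sq (hc _), ← mul_pow]
  refine pow_le_pow_left' ?_ 2
  by_cases hκ0 : ENNReal.ofReal κ = 0
  · rw [hκ0, zero_mul]
    exact bot_le
  have hdiv : ∀ x : ℝ≥0∞, x ≤ ENNReal.ofReal (m * (1 - ρ)⁻¹) / ENNReal.ofReal κ ↔
      ENNReal.ofReal κ * x ≤ ENNReal.ofReal (m * (1 - ρ)⁻¹) := fun x ↦ by
    rw [ENNReal.le_div_iff_mul_le (Or.inl hκ0) (Or.inl ENNReal.ofReal_ne_top), mul_comm]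
  refine (hdiv _).1 ?_
  exact Lp.eLpNorm_le_of_ae_tendsto (u := Filter.atTop)
    (Filter.Eventually.of_forall fun n ↦ (hdiv _).2 (hS n))
    (fun n ↦ (S n).continuous.aestronglyMeasurable) (ae_of_all _ hlim)

/-- Local decay of the dyadic kernels: in `L^2(|z|^{1 - d} dz)` the kernel at the frequency `2^j`
is smaller by `|t|^{(1-d)/2}` than in `L^2`. -/
lemma exists_lintegral_radialWeight_kernel_le (hd : 1 ≤ d) {α : ℝ} (hα : 0 ≤ α) :
    ∃ M : ℝ≥0∞, M ≠ ⊤ ∧ ∀ (t : ℝ) (j : ℕ), ENNReal.ofReal (|t| ^ (d - 1)) *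
      ∫⁻ z : Space d, ‖𝓕⁻ (kernelSymbol α t j) z‖ₑ ^ 2 * radialWeight z ≤
        M * ENNReal.ofReal (((2 : ℝ) ^ j) ^ ((d : ℝ) - 2 * α)) := by
  obtain ⟨M₀, hM₀, h₀⟩ := exists_lintegral_radialWeight_kernel_zero_le hd hα
  obtain ⟨M₁, hM₁, h₁⟩ := exists_lintegral_radialWeight_kernel_succ_le hd α
  refine ⟨M₀ + M₁, ENNReal.add_ne_top.2 ⟨hM₀, hM₁⟩, fun t j ↦ ?_⟩
  cases j with
  | zero => simpa using le_add_right (h₀ t)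
  | succ j => exact (h₁ t j).trans (mul_le_mul_left (le_add_left le_rfl) _)

/-! ### Radial functions seen from a ball -/

/-- Integration in polar coordinates. -/
lemma lintegral_polar (hd : 1 ≤ d) {g : Space d → ℝ≥0∞} (hg : Measurable g) :
    ∫⁻ z, g z = ∫⁻ r in Set.Ioi (0 : ℝ), ENNReal.ofReal (r ^ (d - 1)) *
      ∫⁻ v : Metric.sphere (0 : Space d) 1, g (r • (v : Space d))
        ∂(volume : Measure (Space d)).toSphere := by
  have : Nontrivial (Space d) := by
    have : Nonempty (Fin d) := ⟨⟨0, hd⟩⟩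
    infer_instance
  set σ := (volume : Measure (Space d)).toSphere
  have hm : Measurable fun p : Metric.sphere (0 : Space d) 1 × ℝ ↦ g (p.2 • (p.1 : Space d)) :=
    hg.comp (measurable_snd.smul (measurable_subtype_coe.comp measurable_fst))
  have hm' : Measurable fun r : ℝ ↦ ∫⁻ v : Metric.sphere (0 : Space d) 1, g (r • (v : Space d)) ∂σ :=
    Measurable.lintegral_prod_left hm
  calc ∫⁻ z, g z = ∫⁻ z in ({(0 : Space d)}ᶜ : Set (Space d)), g z := by
        rw [restrict_compl_singleton]
    _ = ∫⁻ z : ({(0 : Space d)}ᶜ : Set (Space d)), g z ∂(volume.comap Subtype.val) :=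
        (lintegral_subtype_comap (measurableSet_singleton _).compl g).symm
    _ = ∫⁻ p, g ((p.2 : ℝ) • (p.1 : Space d)) ∂(σ.prod (Measure.volumeIoiPow (d - 1))) := by
        have h := (volume : Measure (Space d)).measurePreserving_homeomorphUnitSphereProd
        rw [finrank_euclideanSpace_fin] at h
        rw [← h.lintegral_comp_emb (Homeomorph.measurableEmbedding _)]
        refine lintegral_congr fun z ↦ ?_
        congr 1
        have : ‖(z : Space d)‖ ≠ 0 := norm_ne_zero_iff.2 z.2
        simp [smul_smul, this]
    _ = ∫⁻ r : Set.Ioi (0 : ℝ), ∫⁻ v : Metric.sphere (0 : Space d) 1,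
          g ((r : ℝ) • (v : Space d)) ∂σ ∂(Measure.volumeIoiPow (d - 1)) := by
        rw [lintegral_prod_symm]
        exact (hm.comp (measurable_fst.prodMk (measurable_subtype_coe.comp
          measurable_snd))).aemeasurable
    _ = _ := by
        have hm'' : Measurable fun r : Set.Ioi (0 : ℝ) ↦ ∫⁻ v : Metric.sphere (0 : Space d) 1,
            g ((r : ℝ) • (v : Space d)) ∂σ := hm'.comp measurable_subtype_coe
        rw [Measure.volumeIoiPow, lintegral_withDensity_eq_lintegral_mul _ (by fun_prop) hm'']
        exact lintegral_subtype_comap measurableSet_Ioi (fun r : ℝ ↦ ENNReal.ofReal (r ^ (d - 1)) *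
          ∫⁻ v : Metric.sphere (0 : Space d) 1, g (r • (v : Space d)) ∂σ)

/-- A weight that localizes to the unit ball. -/
def ballWeight (y : Space d) : ℝ≥0∞ := ENNReal.ofReal ((1 + ‖y‖) ^ (2 * d))⁻¹

lemma measurable_ballWeight : Measurable (ballWeight : Space d → ℝ≥0∞) := by
  unfold ballWeight; fun_prop

lemma lintegral_ballWeight_lt_top (hd : 1 ≤ d) : ∫⁻ y : Space d, ballWeight y < ⊤ := by
  have h : Integrable (fun y : Space d ↦ (1 + ‖y‖) ^ (-((2 * d : ℕ) : ℝ))) volume := by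
    refine integrable_one_add_norm ?_
    rw [finrank_euclideanSpace_fin]
    exact_mod_cast (by omega : d < 2 * d)
  have h2 : ∀ y : Space d, ballWeight y = ENNReal.ofReal ((1 + ‖y‖) ^ (-((2 * d : ℕ) : ℝ))) :=
    fun y ↦ by rw [ballWeight, Real.rpow_neg (by positivity), Real.rpow_natCast]
  simp_rw [h2]
  exact h.lintegral_lt_top

/-- A unit ball covers at most the fraction `C ρ^{1 - d}` of any sphere of radius `ρ`. -/
lemma exists_sphere_ballWeight_le (hd : 1 ≤ d) :
    ∃ C : ℝ≥0∞, C ≠ ⊤ ∧ ∀ (x : Space d) (ρ : ℝ), 0 < ρ →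
      ENNReal.ofReal (ρ ^ (d - 1)) * ∫⁻ v : Metric.sphere (0 : Space d) 1,
        ballWeight (x - ρ • (v : Space d)) ∂(volume : Measure (Space d)).toSphere ≤ C := by
  refine ⟨ENNReal.ofReal (2 ^ (2 * d)) * ∫⁻ y : Space d, ballWeight y,
    ENNReal.mul_ne_top ENNReal.ofReal_ne_top (lintegral_ballWeight_lt_top hd).ne, fun x ρ hρ ↦ ?_⟩
  set σ := (volume : Measure (Space d)).toSphere
  set A : ℝ → ℝ≥0∞ := fun r ↦ ∫⁻ v : Metric.sphere (0 : Space d) 1,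
    ballWeight (x - r • (v : Space d)) ∂σ
  -- the weight is essentially constant at unit scale, so the sphere can be thickened to a shell
  have hA : ∀ r ∈ Set.Ioc ρ (ρ + 1), A ρ ≤ ENNReal.ofReal (2 ^ (2 * d)) * A r := fun r hr ↦ by
    simp only [A]
    rw [← lintegral_const_mul' _ _ ENNReal.ofReal_ne_top]
    refine lintegral_mono fun v ↦ ?_
    rw [ballWeight, ballWeight, ← ENNReal.ofReal_mul (by positivity)]
    refine ENNReal.ofReal_le_ofReal ?_
    have hv : ‖(v : Space d)‖ = 1 := by simp
    have h1 : ‖x - r • (v : Space d)‖ ≤ ‖x - ρ • (v : Space d)‖ + 1 := by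
      have : x - r • (v : Space d) = (x - ρ • (v : Space d)) - (r - ρ) • (v : Space d) := by
        rw [sub_smul]; abel
      rw [this]
      refine (norm_sub_le _ _).trans (add_le_add le_rfl ?_)
      rw [norm_smul, hv, mul_one, Real.norm_eq_abs, abs_le]
      constructor <;> linarith [hr.1, hr.2]
    rw [← div_eq_mul_inv, le_div_iff₀ (by positivity), inv_mul_le_iff₀ (by positivity), mul_comm,
      ← mul_pow]
    gcongr
    linarith [norm_nonneg (x - ρ • (v : Space d))]
  calc ENNReal.ofReal (ρ ^ (d - 1)) * A ρ
      = ∫⁻ _ in Set.Ioc ρ (ρ + 1), ENNReal.ofReal (ρ ^ (d - 1)) * A ρ := by simp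
    _ ≤ ∫⁻ r in Set.Ioc ρ (ρ + 1), ENNReal.ofReal (2 ^ (2 * d)) *
          (ENNReal.ofReal (r ^ (d - 1)) * A r) := by
        refine setLIntegral_mono' measurableSet_Ioc fun r hr ↦ ?_
        rw [mul_left_comm]
        refine mul_le_mul' (ENNReal.ofReal_le_ofReal ?_) (hA r hr)
        exact pow_le_pow_left₀ hρ.le hr.1.le _
    _ ≤ ∫⁻ r in Set.Ioi (0 : ℝ), ENNReal.ofReal (2 ^ (2 * d)) *
          (ENNReal.ofReal (r ^ (d - 1)) * A r) :=
        lintegral_mono_set fun r hr ↦ hρ.trans hr.1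
    _ = ENNReal.ofReal (2 ^ (2 * d)) * ∫⁻ z, ballWeight (x - z) := by
        rw [lintegral_const_mul' _ _ ENNReal.ofReal_ne_top, lintegral_polar hd
          (g := fun z ↦ ballWeight (x - z))
          (measurable_ballWeight.comp (measurable_const.sub measurable_id))]
    _ = _ := by rw [lintegral_sub_left_eq_self]

/-- The mass of a radial function in a ball of radius `R`, located anywhere, is at most the
fraction `(R / |z|)^{d-1}` of the mass on the spheres `|z| = const`. -/
lemma exists_lintegral_radial_le (hd : 1 ≤ d) :
    ∃ C : ℝ≥0∞, C ≠ ⊤ ∧ ∀ f : Space d → ℝ≥0∞, Measurable f → (∀ z w, ‖z‖ = ‖w‖ → f z = f w) →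
      ∀ R : ℝ, 0 < R → ∀ x : Space d, ∫⁻ y, f (x - y) * ballWeight (R⁻¹ • y) ≤
        C * (ENNReal.ofReal (R ^ (d - 1)) * ∫⁻ z, f z * radialWeight z) := by
  have hne : Nonempty (Fin d) := ⟨⟨0, hd⟩⟩
  have : Nontrivial (Space d) := inferInstance
  obtain ⟨C, hC, h⟩ := exists_sphere_ballWeight_le hd
  set σ := (volume : Measure (Space d)).toSphere with hσ
  have hσ0 : σ Set.univ ≠ 0 := by
    rw [hσ, Measure.toSphere_apply_univ, finrank_euclideanSpace_fin]
    exact mul_ne_zero (by exact_mod_cast (by omega : d ≠ 0))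
      (Metric.measure_ball_pos _ _ one_pos).ne'
  have hσt : σ Set.univ ≠ ⊤ := measure_ne_top _ _
  refine ⟨C * (σ Set.univ)⁻¹, ENNReal.mul_ne_top hC (ENNReal.inv_ne_top.2 hσ0),
    fun f hf hrad R hR x ↦ ?_⟩
  set e : Space d := EuclideanSpace.single (Classical.arbitrary (Fin d)) 1
  have he : ∀ r : ℝ, ∀ v : Metric.sphere (0 : Space d) 1, f (r • (v : Space d)) = f (r • e) :=
    fun r v ↦ hrad _ _ (by
      have hv : ‖(v : Space d)‖ = 1 := by simp
      rw [norm_smul, norm_smul, hv]; simp [e])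
  have h1 : ∫⁻ y, f (x - y) * ballWeight (R⁻¹ • y) = ∫⁻ z, f z * ballWeight (R⁻¹ • (x - z)) := by
    rw [← lintegral_sub_left_eq_self _ x]
    simp
  have hfm : Measurable fun r : ℝ ↦ f (r • e) := hf.comp (measurable_id.smul_const e)
  have h2 : (σ Set.univ) * ∫⁻ r in Set.Ioi (0 : ℝ), f (r • e) = ∫⁻ z, f z * radialWeight z := by
    rw [lintegral_polar hd (g := fun z ↦ f z * radialWeight z) (hf.mul measurable_radialWeight), ← lintegral_const_mul _ hfm]
    refine setLIntegral_congr_fun measurableSet_Ioi fun r hr ↦ ?_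
    have hr' : (0 : ℝ) < r := hr
    have h3 : ∀ v : Metric.sphere (0 : Space d) 1, f (r • (v : Space d)) *
        radialWeight (r • (v : Space d)) = f (r • e) * ENNReal.ofReal (r ^ (d - 1))⁻¹ := fun v ↦ by
      have hv : ‖(v : Space d)‖ = 1 := by simp
      rw [he, radialWeight, norm_smul, hv, mul_one, Real.norm_of_nonneg hr'.le]
    simp only [h3, lintegral_const]
    have h4 : ENNReal.ofReal (r ^ (d - 1)) * ENNReal.ofReal (r ^ (d - 1))⁻¹ = 1 := by
      rw [← ENNReal.ofReal_mul (by positivity), mul_inv_cancel₀ (by positivity), ENNReal.ofReal_one]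
    calc σ Set.univ * f (r • e) = (ENNReal.ofReal (r ^ (d - 1)) * ENNReal.ofReal (r ^ (d - 1))⁻¹) *
          (f (r • e) * σ Set.univ) := by rw [h4, one_mul, mul_comm]
      _ = _ := by ring
  rw [h1, lintegral_polar hd (g := fun z ↦ f z * ballWeight (R⁻¹ • (x - z))) (hf.mul (measurable_ballWeight.comp
    (by fun_prop : Measurable fun z : Space d ↦ R⁻¹ • (x - z)))), ← h2]
  have h5 : ∀ r ∈ Set.Ioi (0 : ℝ), ENNReal.ofReal (r ^ (d - 1)) *
      ∫⁻ v : Metric.sphere (0 : Space d) 1, f (r • (v : Space d)) *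
        ballWeight (R⁻¹ • (x - r • (v : Space d))) ∂σ ≤
      C * ENNReal.ofReal (R ^ (d - 1)) * f (r • e) := fun r hr ↦ by
    have hr' : (0 : ℝ) < r := hr
    have h6 := h (R⁻¹ • x) (R⁻¹ * r) (by positivity)
    simp_rw [he, smul_sub, smul_smul]
    have h8 : Measurable fun v : Metric.sphere (0 : Space d) 1 ↦
        ballWeight (R⁻¹ • x - (R⁻¹ * r) • (v : Space d)) :=
      measurable_ballWeight.comp (by fun_prop)
    rw [lintegral_const_mul _ h8]
    have h7 : ENNReal.ofReal (r ^ (d - 1)) =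
        ENNReal.ofReal (R ^ (d - 1)) * ENNReal.ofReal ((R⁻¹ * r) ^ (d - 1)) := by
      rw [← ENNReal.ofReal_mul (by positivity), ← mul_pow, mul_inv_cancel_left₀ hR.ne']
    rw [h7]
    refine le_trans (le_of_eq ?_) (mul_le_mul_left (mul_le_mul_left h6
      (ENNReal.ofReal (R ^ (d - 1)))) (f (r • e)))
    ring
  refine (setLIntegral_mono' measurableSet_Ioi h5).trans (le_of_eq ?_)
  rw [lintegral_const_mul _ hfm]
  calc _ = ((σ Set.univ)⁻¹ * σ Set.univ) * (C * ENNReal.ofReal (R ^ (d - 1)) *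
        ∫⁻ r in Set.Ioi (0 : ℝ), f (r • e)) := by rw [ENNReal.inv_mul_cancel hσ0 hσt, one_mul]
    _ = _ := by ring

/-! ### Localization is bounded on Sobolev spaces -/

/-- The Cauchy-Schwarz inequality. -/
lemma lintegral_sq_le {X : Type*} [MeasurableSpace X] {μ : Measure X} {a b c : X → ℝ≥0∞}
    (ha : AEMeasurable a μ) (hb : AEMeasurable b μ) (h : ∀ x, c x ^ 2 ≤ a x * b x) :
    (∫⁻ x, c x ∂μ) ^ 2 ≤ (∫⁻ x, a x ∂μ) * ∫⁻ x, b x ∂μ := by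
  have h1 : ∀ y : ℝ≥0∞, (y ^ (1 / 2 : ℝ)) ^ 2 = y := fun y ↦ by
    rw [← ENNReal.rpow_natCast, ← ENNReal.rpow_mul]; norm_num
  have h2 : ∀ x, c x ≤ a x ^ (1 / 2 : ℝ) * b x ^ (1 / 2 : ℝ) := fun x ↦ by
    rw [← ENNReal.pow_le_pow_left_iff two_ne_zero, mul_pow, h1, h1]
    exact h x
  calc (∫⁻ x, c x ∂μ) ^ 2
      ≤ ((∫⁻ x, a x ∂μ) ^ (1 / 2 : ℝ) * (∫⁻ x, b x ∂μ) ^ (1 / 2 : ℝ)) ^ 2 := by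
        gcongr
        exact (lintegral_mono h2).trans (ENNReal.lintegral_mul_norm_pow_le ha hb (by norm_num)
          (by norm_num) (by norm_num))
    _ = _ := by rw [mul_pow, h1, h1]

/-- Young's inequality `L¹ * L² ⊆ L²`. -/
lemma lintegral_sq_convolution_le {u v : Space d → ℝ≥0∞} (hu : Measurable u) (hv : Measurable v) :
    ∫⁻ ξ, (∫⁻ ζ, u ζ * v (ξ - ζ)) ^ 2 ≤ (∫⁻ ζ, u ζ) ^ 2 * ∫⁻ ξ, v ξ ^ 2 := by
  have hm : Measurable fun p : Space d × Space d ↦ u p.2 * v (p.1 - p.2) ^ 2 :=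
    (hu.comp measurable_snd).mul ((hv.comp (measurable_fst.sub measurable_snd)).pow_const 2)
  calc ∫⁻ ξ, (∫⁻ ζ, u ζ * v (ξ - ζ)) ^ 2
      ≤ ∫⁻ ξ, (∫⁻ ζ, u ζ) * ∫⁻ ζ, u ζ * v (ξ - ζ) ^ 2 := by
        refine lintegral_mono fun ξ ↦ lintegral_sq_le hu.aemeasurable
          (hm.comp (measurable_const.prodMk measurable_id)).aemeasurable fun ζ ↦ le_of_eq ?_
        ring
    _ = (∫⁻ ζ, u ζ) * ∫⁻ ζ, ∫⁻ ξ, u ζ * v (ξ - ζ) ^ 2 := by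
        rw [lintegral_const_mul _ hm.lintegral_prod_right, lintegral_lintegral_swap hm.aemeasurable]
    _ = (∫⁻ ζ, u ζ) * ∫⁻ ζ, u ζ * ∫⁻ ξ, v ξ ^ 2 := by
        congr 1
        refine lintegral_congr fun ζ ↦ ?_
        have hm' : Measurable fun ξ ↦ v (ξ - ζ) ^ 2 :=
          (hv.comp (measurable_id.sub_const ζ)).pow_const 2
        rw [lintegral_const_mul _ hm', lintegral_sub_right_eq_self (fun ξ ↦ v ξ ^ 2) ζ]
    _ = _ := by rw [lintegral_mul_const _ hu, sq, mul_assoc]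

/-- The weight `⟨2πξ⟩^s`. -/
def sobolevWeight (s : ℝ) (ξ : Space d) : ℝ≥0∞ :=
  ENNReal.ofReal (bracket ((2 * Real.pi) • ξ) ^ s)

lemma measurable_sobolevWeight (s : ℝ) : Measurable (sobolevWeight s : Space d → ℝ≥0∞) := by
  unfold sobolevWeight bracket; fun_prop

/-- Peetre's inequality. -/
lemma sobolevWeight_le {s : ℝ} (hs : 0 ≤ s) (ξ ζ : Space d) : sobolevWeight s ξ ≤
    ENNReal.ofReal (2 ^ s) * (sobolevWeight s ζ * sobolevWeight s (ξ - ζ)) := by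
  have h := bracket_add_le ((2 * Real.pi) • ζ) ((2 * Real.pi) • (ξ - ζ))
  rw [← smul_add, add_sub_cancel] at h
  have h1 := bracket_pos ((2 * Real.pi) • ζ)
  have h2 := bracket_pos ((2 * Real.pi) • (ξ - ζ))
  rw [sobolevWeight, sobolevWeight, sobolevWeight, ← ENNReal.ofReal_mul (by positivity),
    ← ENNReal.ofReal_mul (by positivity), ← Real.mul_rpow h1.le h2.le,
    ← Real.mul_rpow (by norm_num) (by positivity)]
  exact ENNReal.ofReal_le_ofReal (Real.rpow_le_rpow (bracket_pos _).le h hs)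

lemma sobolevWeight_smul_le {s c M : ℝ} (hs : 0 ≤ s) (hM : 1 ≤ M) (hc : |c| ≤ M) (ξ : Space d) :
    sobolevWeight s (c • ξ) ≤ ENNReal.ofReal (M ^ s) * sobolevWeight s ξ := by
  have h1 := bracket_pos ((2 * Real.pi) • ξ)
  rw [sobolevWeight, sobolevWeight, ← ENNReal.ofReal_mul (by positivity),
    ← Real.mul_rpow (by positivity) h1.le]
  refine ENNReal.ofReal_le_ofReal (Real.rpow_le_rpow (bracket_pos _).le ?_ hs)
  rw [bracket, bracket, ← Real.sqrt_sq (zero_le_one.trans hM), ← Real.sqrt_mul (by positivity),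
    smul_comm, norm_smul, mul_pow, Real.norm_eq_abs]
  refine Real.sqrt_le_sqrt ?_
  have h2 : |c| ^ 2 ≤ M ^ 2 := by gcongr
  have h3 : 1 ≤ M ^ 2 := one_le_pow₀ hM
  nlinarith [mul_le_mul_of_nonneg_right h2 (sq_nonneg ‖(2 * Real.pi) • ξ‖)]

lemma lintegral_sobolevWeight_mul_lt_top (s : ℝ) (k : 𝓢(Space d, ℂ)) :
    ∫⁻ ξ, sobolevWeight s ξ * ‖k ξ‖ₑ < ⊤ := by
  have h := (SchwartzMap.smulLeftCLM ℂ (fun ξ ↦ ((bracket ((2 * Real.pi) • ξ) ^ s : ℝ) : ℂ))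
    k).integrable (μ := volume)
  refine lt_of_le_of_lt (le_of_eq (lintegral_congr fun ξ ↦ ?_)) h.2
  rw [SchwartzMap.smulLeftCLM_apply_apply (hasTemperateGrowth_bracket_rpow s _), enorm_smul,
    sobolevWeight]
  congr 1
  rw [← ofReal_norm, Complex.norm_real, Real.norm_of_nonneg]
  exact Real.rpow_nonneg (bracket_pos _).le _

/-- The dilation `f ↦ f(c ·)`. -/
def dilate {c : ℝ} (hc : c ≠ 0) : 𝓢(Space d, ℂ) →L[ℂ] 𝓢(Space d, ℂ) :=
  SchwartzMap.compCLMOfContinuousLinearEquiv ℂ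
    (ContinuousLinearEquiv.smulLeft (M₁ := Space d) (Units.mk0 c hc))

@[simp] lemma dilate_apply {c : ℝ} (hc : c ≠ 0) (f : 𝓢(Space d, ℂ)) (x : Space d) :
    dilate hc f x = f (c • x) := rfl

/-- Multiplication of a Schwartz function by `x ↦ χ(x / R)`. -/
def localizeCLM (χ : 𝓢(Space d, ℂ)) {R : ℝ} (hR : 0 < R) : 𝓢(Space d, ℂ) →L[ℂ] 𝓢(Space d, ℂ) :=
  SchwartzMap.smulLeftCLM ℂ (dilate (inv_ne_zero hR.ne') χ)

lemma localizeCLM_apply (χ : 𝓢(Space d, ℂ)) {R : ℝ} (hR : 0 < R) (f : 𝓢(Space d, ℂ))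
    (x : Space d) : localizeCLM χ hR f x = χ (R⁻¹ • x) * f x := by
  rw [localizeCLM, SchwartzMap.smulLeftCLM_apply_apply (SchwartzMap.hasTemperateGrowth _),
    dilate_apply, smul_eq_mul]

/-- The Fourier transform of a product is the convolution of the Fourier transforms. -/
lemma fourier_smulLeftCLM_eq (φ f : 𝓢(Space d, ℂ)) (ξ : Space d) :
    𝓕 (SchwartzMap.smulLeftCLM ℂ φ f) ξ = ∫ ζ, 𝓕 φ ζ * 𝓕 f (ξ - ζ) := by
  have h := SchwartzMap.convolution_apply (ContinuousLinearMap.mul ℂ ℂ) (𝓕 φ) (𝓕 f) ξ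
  rw [MeasureTheory.convolution] at h
  simp only [ContinuousLinearMap.mul_apply'] at h
  have h1 : ∀ (k : 𝓢(Space d, ℂ)) (x : Space d), 𝓕 (𝓕 k) (-x) = k x := fun k x ↦ by
    have := congrArg (fun F : 𝓢(Space d, ℂ) ↦ F x) (fourierInv_fourier_eq (F := 𝓢(Space d, ℂ)) k)
    simp only [SchwartzMap.fourierInv_coe, Real.fourierInv_eq_fourier_neg] at this
    exact this
  have h2 : SchwartzMap.convolution (ContinuousLinearMap.mul ℂ ℂ) (𝓕 φ) (𝓕 f) =
      𝓕⁻ (SchwartzMap.pairing (ContinuousLinearMap.mul ℂ ℂ) (𝓕 (𝓕 φ)) (𝓕 (𝓕 f))) := rfl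
  rw [← h, h2, SchwartzMap.fourierInv_coe, SchwartzMap.fourier_coe,
    Real.fourierInv_eq_fourier_comp_neg]
  refine congrFun (congrArg (𝓕 : (Space d → ℂ) → Space d → ℂ) (funext fun x ↦ ?_)) ξ
  rw [SchwartzMap.pairing_apply_apply, h1, h1,
    SchwartzMap.smulLeftCLM_apply_apply (SchwartzMap.hasTemperateGrowth _)]
  rfl

lemma exists_lintegral_sobolevWeight_fourier_dilate_le {s R₀ : ℝ} (hs : 0 ≤ s) (hR₀ : 0 < R₀)
    (χ : 𝓢(Space d, ℂ)) : ∃ C : ℝ≥0∞, C ≠ ⊤ ∧ ∀ (R : ℝ) (hR : 0 < R), R₀ ≤ R →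
      ∫⁻ ζ, sobolevWeight s ζ * ‖𝓕 (dilate (inv_ne_zero hR.ne') χ) ζ‖ₑ ≤ C := by
  refine ⟨ENNReal.ofReal ((max 1 R₀⁻¹) ^ s) * ∫⁻ ξ, sobolevWeight s ξ * ‖𝓕 χ ξ‖ₑ,
    ENNReal.mul_ne_top ENNReal.ofReal_ne_top (lintegral_sobolevWeight_mul_lt_top s _).ne,
    fun R hR hRR ↦ ?_⟩
  have h1 : ∀ ζ, 𝓕 (dilate (inv_ne_zero hR.ne') χ) ζ = ((R ^ d : ℝ) : ℂ) * 𝓕 χ (R • ζ) := by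
    intro ζ
    have := fourierInv_dilation (k := dilate (inv_ne_zero hR.ne') χ) (h := χ) (c := 1) hR
      (fun ξ ↦ by simp) (-ζ)
    simpa [SchwartzMap.fourierInv_coe, SchwartzMap.fourier_coe,
      Real.fourierInv_eq_fourier_neg] using this
  have hm : Measurable fun ξ ↦ sobolevWeight s (R⁻¹ • ξ) * ‖𝓕 χ ξ‖ₑ :=
    ((measurable_sobolevWeight s).comp (measurable_const_smul _)).mul
      (SchwartzMap.continuous _).enorm.measurable
  have h2 : ∀ ζ, sobolevWeight s ζ * ‖𝓕 (dilate (inv_ne_zero hR.ne') χ) ζ‖ₑ =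
      ENNReal.ofReal (R ^ d) * (sobolevWeight s (R⁻¹ • R • ζ) * ‖𝓕 χ (R • ζ)‖ₑ) := fun ζ ↦ by
    rw [h1, enorm_mul, inv_smul_smul₀ hR.ne', ← ofReal_norm ((R ^ d : ℝ) : ℂ), Complex.norm_real,
      Real.norm_of_nonneg (by positivity)]
    ring
  simp_rw [h2]
  rw [lintegral_const_mul' _ _ ENNReal.ofReal_ne_top, lintegral_comp_smul_eq hR hm, ← mul_assoc,
    ← ENNReal.ofReal_mul (by positivity), mul_inv_cancel₀ (by positivity), ENNReal.ofReal_one,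
    one_mul, ← lintegral_const_mul' _ _ ENNReal.ofReal_ne_top]
  refine lintegral_mono fun ξ ↦ ?_
  rw [← mul_assoc]
  refine mul_le_mul_left (sobolevWeight_smul_le hs (le_max_left _ _) ?_ ξ) _
  rw [abs_of_pos (by positivity)]
  exact (inv_anti₀ hR₀ hRR).trans (le_max_right _ _)

/-- Multiplication by `χ(· / R)` is bounded on `H^s`, uniformly in `R ≥ R₀`. -/
lemma exists_lintegral_sobolevWeight_localizeCLM_le {s R₀ : ℝ} (hs : 0 ≤ s) (hR₀ : 0 < R₀)
    (χ : 𝓢(Space d, ℂ)) : ∃ C : ℝ≥0∞, C ≠ ⊤ ∧ ∀ (R : ℝ) (hR : 0 < R), R₀ ≤ R →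
      ∀ f : 𝓢(Space d, ℂ), ∫⁻ ξ, (sobolevWeight s ξ * ‖𝓕 (localizeCLM χ hR f) ξ‖ₑ) ^ 2 ≤
        C * ∫⁻ ξ, (sobolevWeight s ξ * ‖𝓕 f ξ‖ₑ) ^ 2 := by
  obtain ⟨C, hC, h⟩ := exists_lintegral_sobolevWeight_fourier_dilate_le hs hR₀ χ
  refine ⟨ENNReal.ofReal (2 ^ s) ^ 2 * C ^ 2, by finiteness, fun R hR hRR f ↦ ?_⟩
  set u : Space d → ℝ≥0∞ := fun ζ ↦ sobolevWeight s ζ * ‖𝓕 (dilate (inv_ne_zero hR.ne') χ) ζ‖ₑ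
  set v : Space d → ℝ≥0∞ := fun ζ ↦ sobolevWeight s ζ * ‖𝓕 f ζ‖ₑ
  have hu : Measurable u := (measurable_sobolevWeight s).mul
    (SchwartzMap.continuous _).enorm.measurable
  have hv : Measurable v := (measurable_sobolevWeight s).mul
    (SchwartzMap.continuous _).enorm.measurable
  have h1 : ∀ ξ, sobolevWeight s ξ * ‖𝓕 (localizeCLM χ hR f) ξ‖ₑ ≤
      ENNReal.ofReal (2 ^ s) * ∫⁻ ζ, u ζ * v (ξ - ζ) := fun ξ ↦ by
    rw [localizeCLM, fourier_smulLeftCLM_eq]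
    calc _ ≤ sobolevWeight s ξ *
          ∫⁻ ζ, ‖𝓕 (dilate (inv_ne_zero hR.ne') χ) ζ * 𝓕 f (ξ - ζ)‖ₑ := by
          gcongr
          exact enorm_integral_le_lintegral_enorm _
      _ ≤ ∫⁻ ζ, sobolevWeight s ξ * ‖𝓕 (dilate (inv_ne_zero hR.ne') χ) ζ * 𝓕 f (ξ - ζ)‖ₑ := by
          rw [lintegral_const_mul' _ _ (by unfold sobolevWeight; finiteness)]
      _ ≤ ∫⁻ ζ, ENNReal.ofReal (2 ^ s) * (u ζ * v (ξ - ζ)) := by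
          refine lintegral_mono fun ζ ↦ ?_
          refine (mul_le_mul_left (sobolevWeight_le hs ξ ζ) _).trans (le_of_eq ?_)
          simp only [u, v, enorm_mul]
          ring
      _ = _ := by rw [lintegral_const_mul' _ _ ENNReal.ofReal_ne_top]
  calc ∫⁻ ξ, (sobolevWeight s ξ * ‖𝓕 (localizeCLM χ hR f) ξ‖ₑ) ^ 2
      ≤ ∫⁻ ξ, ENNReal.ofReal (2 ^ s) ^ 2 * (∫⁻ ζ, u ζ * v (ξ - ζ)) ^ 2 := by
        refine lintegral_mono fun ξ ↦ ?_
        rw [← mul_pow]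
        exact pow_le_pow_left' (h1 ξ) 2
    _ ≤ ENNReal.ofReal (2 ^ s) ^ 2 * ((∫⁻ ζ, u ζ) ^ 2 * ∫⁻ ξ, v ξ ^ 2) := by
        rw [lintegral_const_mul' _ _ (by finiteness)]
        gcongr
        exact lintegral_sq_convolution_le hu hv
    _ ≤ _ := by
        rw [← mul_assoc]
        gcongr
        exact h R hR hRR

/-! ### Weighted square functions of localized functions -/

/-- A symbol supported in a dyadic ring, away from the origin. -/
def IsRingSupported (b : 𝓢(Space d, ℂ)) : Prop :=
  ∃ c : ℝ, 0 < c ∧ ∃ C : ℝ, ∀ ξ, b ξ ≠ 0 → c ≤ ‖ξ‖ ∧ ‖ξ‖ ≤ C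

lemma IsRingSupported.lineDeriv {b : 𝓢(Space d, ℂ)} (hb : IsRingSupported b) (m : Space d) :
    IsRingSupported (∂_{m} b) := by
  obtain ⟨c, hc, C, h⟩ := hb
  refine ⟨c, hc, C, fun ξ hξ ↦ ?_⟩
  have h1 : tsupport b ⊆ {ξ | c ≤ ‖ξ‖ ∧ ‖ξ‖ ≤ C} :=
    closure_minimal (fun ξ hξ ↦ h ξ hξ) ((isClosed_le continuous_const continuous_norm).inter
      (isClosed_le continuous_norm continuous_const))
  exact h1 (SchwartzMap.tsupport_lineDerivOp_subset m b (subset_tsupport _ hξ))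

/-- The inhomogeneous dyadic family of symbols `b₀`, `b(2^{-j} ·)`. -/
def dyadicDilate (b₀ b : 𝓢(Space d, ℂ)) : ℕ → 𝓢(Space d, ℂ)
  | 0 => b₀
  | j + 1 => dilate (c := (2 ^ (j + 1))⁻¹) (by positivity) b

lemma lineDeriv_dyadicDilate (b₀ b : 𝓢(Space d, ℂ)) (m : Space d) (j : ℕ) :
    ∂_{m} (dyadicDilate b₀ b j) = (((2 : ℝ) ^ j)⁻¹ : ℝ) • dyadicDilate (∂_{m} b₀) (∂_{m} b) j := by
  cases j with
  | zero => simp [dyadicDilate]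
  | succ j =>
    simp only [dyadicDilate, dilate]
    rw [SchwartzMap.lineDerivOp_compCLMOfContinuousLinearEquiv]
    ext ξ
    simp [SchwartzMap.lineDerivOp_apply_eq_fderiv, Units.smul_def]

/-- At each frequency only boundedly many of the dyadic symbols are active, and there the frequency
is comparable to `2^j`. -/
lemma exists_tsum_dyadicDilate_le {s : ℝ} (hs : 0 ≤ s) (b₀ : 𝓢(Space d, ℂ)) {b : 𝓢(Space d, ℂ)}
    (hb : IsRingSupported b) : ∃ C : ℝ≥0∞, C ≠ ⊤ ∧ ∀ ξ,
      ∑' j, (ENNReal.ofReal (((2 : ℝ) ^ j) ^ s) * ‖dyadicDilate b₀ b j ξ‖ₑ) ^ 2 ≤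
        C * sobolevWeight s ξ ^ 2 := by
  obtain ⟨c, hc, C, h⟩ := hb
  obtain ⟨M₀, hM₀, hb₀⟩ := b₀.toBoundedContinuousFunction.isBounded_range.exists_pos_norm_le
  obtain ⟨M, hM, hbM⟩ := b.toBoundedContinuousFunction.isBounded_range.exists_pos_norm_le
  obtain ⟨N, hN⟩ := pow_unbounded_of_one_lt (C / c) (one_lt_two (α := ℝ))
  set K : ℝ≥0∞ := ENNReal.ofReal (c⁻¹ ^ s) * ENNReal.ofReal M
  refine ⟨ENNReal.ofReal M₀ ^ 2 + (N + 1 : ℕ) * K ^ 2, by simp only [K]; finiteness, fun ξ ↦ ?_⟩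
  rw [tsum_eq_zero_add' ENNReal.summable, add_mul]
  refine add_le_add ?_ ?_
  · simp only [pow_zero, Real.one_rpow, ENNReal.ofReal_one, one_mul, dyadicDilate]
    have h1 : ‖b₀ ξ‖ₑ ≤ ENNReal.ofReal M₀ := by
      rw [← ofReal_norm]
      exact ENNReal.ofReal_le_ofReal (hb₀ _ ⟨ξ, rfl⟩)
    have h2 : 1 ≤ sobolevWeight s ξ := by
      rw [sobolevWeight, ENNReal.one_le_ofReal]
      exact Real.one_le_rpow (one_le_bracket _) hs
    calc ‖b₀ ξ‖ₑ ^ 2 ≤ ENNReal.ofReal M₀ ^ 2 * 1 ^ 2 := by rw [one_pow, mul_one]; gcongr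
      _ ≤ _ := by gcongr
  set F : ℕ → ℝ≥0∞ := fun j ↦
    (ENNReal.ofReal (((2 : ℝ) ^ (j + 1)) ^ s) * ‖dyadicDilate b₀ b (j + 1) ξ‖ₑ) ^ 2
  have hne : ∀ j, F j ≠ 0 → c * 2 ^ (j + 1) ≤ ‖ξ‖ ∧ ‖ξ‖ ≤ C * 2 ^ (j + 1) := fun j hj ↦ by
    have h1 : b (((2 : ℝ) ^ (j + 1))⁻¹ • ξ) ≠ 0 := fun h0 ↦ hj (by simp [F, dyadicDilate, h0])
    have h2 := h _ h1
    rw [norm_smul, Real.norm_of_nonneg (by positivity), inv_mul_eq_div,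
      le_div_iff₀ (by positivity), div_le_iff₀ (by positivity)] at h2
    exact h2
  have hF : ∀ j, F j ≤ K ^ 2 * sobolevWeight s ξ ^ 2 := fun j ↦ by
    by_cases hj : F j = 0
    · simp [hj]
    have h1 := (hne j hj).1
    have h2 : (2 : ℝ) ^ (j + 1) ≤ c⁻¹ * bracket ((2 * Real.pi) • ξ) := by
      rw [inv_mul_eq_div, le_div_iff₀ hc, mul_comm]
      refine h1.trans (le_trans ?_ (norm_le_bracket _))
      rw [norm_smul, Real.norm_of_nonneg (by positivity)]
      nlinarith [norm_nonneg ξ, Real.pi_gt_three]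
    rw [← mul_pow]
    refine pow_le_pow_left' ?_ 2
    calc _ ≤ ENNReal.ofReal ((c⁻¹ * bracket ((2 * Real.pi) • ξ)) ^ s) * ENNReal.ofReal M := by
          gcongr
          rw [← ofReal_norm]
          exact ENNReal.ofReal_le_ofReal (hbM _ ⟨_, rfl⟩)
      _ = _ := by
          rw [Real.mul_rpow (by positivity) (bracket_pos _).le, ENNReal.ofReal_mul (by positivity)]
          simp only [K, sobolevWeight]
          ring
  by_cases hall : ∀ j, F j = 0
  · rw [ENNReal.tsum_eq_zero.2 hall]
    exact zero_le
  rw [not_forall] at hall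
  classical
  -- the active indices lie in `[j₀, j₀ + N]`, where `j₀` is the first one and `2 ^ N > C / c`
  set j₀ := Nat.find hall
  have h0 : ∀ j ∉ Finset.Icc j₀ (j₀ + N), F j = 0 := fun j hj ↦ by
    by_contra hj'
    have h1 : j₀ ≤ j := Nat.find_min' hall hj'
    have h2 : j₀ + N < j := by
      rw [Finset.mem_Icc] at hj; omega
    have h3 := (hne j hj').1.trans (hne _ (Nat.find_spec hall)).2
    have h4 : (2 : ℝ) ^ (j₀ + 1) * 2 ^ N ≤ 2 ^ (j + 1) := by
      rw [← pow_add]; exact pow_le_pow_right₀ one_le_two (by omega)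
    have h5 : C < c * 2 ^ N := by rwa [div_lt_iff₀ hc, mul_comm] at hN
    have h6 : (0 : ℝ) < 2 ^ (j₀ + 1) := by positivity
    change c * 2 ^ (j + 1) ≤ C * 2 ^ (j₀ + 1) at h3
    nlinarith [mul_le_mul_of_nonneg_left h4 hc.le, mul_lt_mul_of_pos_right h5 h6]
  rw [tsum_eq_sum h0]
  refine (Finset.sum_le_card_nsmul _ _ _ fun j _ ↦ hF j).trans (le_of_eq ?_)
  rw [Nat.card_Icc, show j₀ + N + 1 - j₀ = N + 1 by omega, nsmul_eq_mul, mul_assoc]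

/-- Commutator of a Fourier multiplier with multiplication by a coordinate. -/
lemma inner_mul_fourierMultiplierCLM (a g : 𝓢(Space d, ℂ)) (m x : Space d) :
    ((inner ℝ x m : ℝ) : ℂ) * SchwartzMap.fourierMultiplierCLM ℂ a g x =
      SchwartzMap.fourierMultiplierCLM ℂ a (SchwartzMap.smulLeftCLM ℂ (inner ℝ · m) g) x -
        (2 * Real.pi * Complex.I)⁻¹ * SchwartzMap.fourierMultiplierCLM ℂ
          (∂_{m} a : 𝓢(Space d, ℂ)) g x := by
  have hm : (inner ℝ · m : Space d → ℝ).HasTemperateGrowth := by fun_prop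
  have ha := a.hasTemperateGrowth
  have h1 : ∂_{m} (SchwartzMap.smulLeftCLM ℂ a (𝓕 g)) =
      SchwartzMap.smulLeftCLM ℂ (∂_{m} a : 𝓢(Space d, ℂ)) (𝓕 g) +
        SchwartzMap.smulLeftCLM ℂ a (∂_{m} (𝓕 g)) := by
    ext ξ
    rw [add_apply, SchwartzMap.smulLeftCLM_apply_apply (SchwartzMap.hasTemperateGrowth _),
      SchwartzMap.smulLeftCLM_apply_apply ha, SchwartzMap.lineDerivOp_apply_eq_fderiv,
      SchwartzMap.lineDerivOp_apply_eq_fderiv, SchwartzMap.lineDerivOp_apply_eq_fderiv,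
      SchwartzMap.smulLeftCLM_apply ha]
    simp only [smul_eq_mul]
    rw [fderiv_fun_mul a.differentiableAt (SchwartzMap.differentiableAt _)]
    simp
    ring
  have h2 := congrArg (fun F : 𝓢(Space d, ℂ) ↦ (𝓕⁻ F : 𝓢(Space d, ℂ)) x) h1
  simp only [SchwartzMap.fourierInv_lineDerivOp_eq, SchwartzMap.lineDerivOp_fourier_eq,
    FourierTransform.fourierInv_add, FourierTransform.fourier_smul, map_smul,
    FourierTransform.fourierInv_smul, add_apply, smul_apply,
    SchwartzMap.smulLeftCLM_apply_apply hm] at h2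
  simp only [← SchwartzMap.fourierMultiplierCLM_apply] at h2
  have h3 : (2 * Real.pi * Complex.I : ℂ) ≠ 0 := by
    simp [Real.pi_ne_zero]
  simp only [smul_eq_mul, Complex.real_smul] at h2
  field_simp
  linear_combination -h2

lemma smulLeftCLM_inner_localizeCLM (χ : 𝓢(Space d, ℂ)) {R : ℝ} (hR : 0 < R) (f : 𝓢(Space d, ℂ))
    (m : Space d) : SchwartzMap.smulLeftCLM ℂ (inner ℝ · m) (localizeCLM χ hR f) =
      (R : ℂ) • localizeCLM (SchwartzMap.smulLeftCLM ℂ (inner ℝ · m) χ) hR f := by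
  have hm : (inner ℝ · m : Space d → ℝ).HasTemperateGrowth := by fun_prop
  ext x
  rw [SchwartzMap.smulLeftCLM_apply_apply hm, smul_apply, localizeCLM_apply, localizeCLM_apply,
    SchwartzMap.smulLeftCLM_apply_apply hm, inner_smul_left]
  simp only [conj_trivial, Complex.real_smul, smul_eq_mul]
  push_cast
  have : (R : ℂ) ≠ 0 := by exact_mod_cast hR.ne'
  field_simp

lemma lintegral_fourierMultiplierCLM (a g : 𝓢(Space d, ℂ)) :
    ∫⁻ y, ‖SchwartzMap.fourierMultiplierCLM ℂ a g y‖ₑ ^ 2 = ∫⁻ ξ, (‖a ξ‖ₑ * ‖𝓕 g ξ‖ₑ) ^ 2 := by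
  rw [SchwartzMap.fourierMultiplierCLM_apply, lintegral_enorm_sq_fourierInv]
  refine lintegral_congr fun ξ ↦ ?_
  rw [SchwartzMap.smulLeftCLM_apply_apply a.hasTemperateGrowth, enorm_smul]

lemma fourierMultiplierCLM_real_smul (c : ℝ) (a g : 𝓢(Space d, ℂ)) :
    SchwartzMap.fourierMultiplierCLM ℂ (c • a : 𝓢(Space d, ℂ)) g =
      c • SchwartzMap.fourierMultiplierCLM ℂ a g := by
  have h : SchwartzMap.smulLeftCLM ℂ (c • a : 𝓢(Space d, ℂ)) (𝓕 g) =
      c • SchwartzMap.smulLeftCLM ℂ a (𝓕 g) := by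
    ext ξ
    rw [SchwartzMap.smulLeftCLM_apply_apply (SchwartzMap.hasTemperateGrowth _), smul_apply,
      smul_apply, SchwartzMap.smulLeftCLM_apply_apply a.hasTemperateGrowth, smul_assoc]
  rw [SchwartzMap.fourierMultiplierCLM_apply, h, FourierTransform.fourierInv_smul]
  rfl

/-- Square functions of localized functions decay rapidly away from the ball of radius `R`. -/
lemma exists_tsum_lintegral_inner_pow_le {s R₀ : ℝ} (hs : 0 ≤ s) (hR₀ : 0 < R₀) (m : Space d)
    (n : ℕ) : ∀ (b₀ : 𝓢(Space d, ℂ)) {b : 𝓢(Space d, ℂ)} (_ : IsRingSupported b)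
      (χ : 𝓢(Space d, ℂ)), ∃ C : ℝ≥0∞, C ≠ ⊤ ∧ ∀ (R : ℝ) (hR : 0 < R), R₀ ≤ R →
      ∀ f : 𝓢(Space d, ℂ), ∑' j, ∫⁻ y, (ENNReal.ofReal (((2 : ℝ) ^ j) ^ s) *
          (‖inner ℝ (R⁻¹ • y) m‖ₑ ^ n * ‖SchwartzMap.fourierMultiplierCLM ℂ
            (dyadicDilate b₀ b j) (localizeCLM χ hR f) y‖ₑ)) ^ 2 ≤
        C * ∫⁻ ξ, (sobolevWeight s ξ * ‖𝓕 f ξ‖ₑ) ^ 2 := by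
  induction n with
  | zero =>
    intro b₀ b hb χ
    obtain ⟨C, hC, h⟩ := exists_tsum_dyadicDilate_le hs b₀ hb
    obtain ⟨C', hC', h'⟩ := exists_lintegral_sobolevWeight_localizeCLM_le hs hR₀ χ
    refine ⟨C * C', by finiteness, fun R hR hRR f ↦ ?_⟩
    set g := localizeCLM χ hR f
    have hm : ∀ a : 𝓢(Space d, ℂ), Measurable fun ξ ↦ ‖a ξ‖ₑ := fun a ↦
      a.continuous.enorm.measurable
    calc _ = ∑' j, ∫⁻ ξ, (ENNReal.ofReal (((2 : ℝ) ^ j) ^ s) * ‖dyadicDilate b₀ b j ξ‖ₑ) ^ 2 *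
          ‖𝓕 g ξ‖ₑ ^ 2 := by
          refine tsum_congr fun j ↦ ?_
          simp only [pow_zero, one_mul, mul_pow]
          rw [lintegral_const_mul' _ _ (by finiteness), lintegral_fourierMultiplierCLM,
            ← lintegral_const_mul' _ _ (by finiteness)]
          exact lintegral_congr fun ξ ↦ by ring
      _ = ∫⁻ ξ, (∑' j, (ENNReal.ofReal (((2 : ℝ) ^ j) ^ s) * ‖dyadicDilate b₀ b j ξ‖ₑ) ^ 2) *
          ‖𝓕 g ξ‖ₑ ^ 2 := by
          simp_rw [← ENNReal.tsum_mul_right]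
          rw [lintegral_tsum]
          exact fun j ↦ ((((hm _).const_mul _).pow_const 2).mul
            ((hm _).pow_const 2)).aemeasurable
      _ ≤ ∫⁻ ξ, C * (sobolevWeight s ξ * ‖𝓕 g ξ‖ₑ) ^ 2 := by
          refine lintegral_mono fun ξ ↦ ?_
          rw [mul_pow, ← mul_assoc]
          exact mul_le_mul_left (h ξ) _
      _ ≤ _ := by
          rw [lintegral_const_mul' _ _ hC, mul_assoc]
          gcongr
          exact h' R hR hRR f
  | succ n ih =>
    intro b₀ b hb χ
    obtain ⟨C, hC, h⟩ := ih b₀ hb (SchwartzMap.smulLeftCLM ℂ (inner ℝ · m) χ)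
    obtain ⟨C', hC', h'⟩ := ih (∂_{m} b₀) (hb.lineDeriv m) χ
    refine ⟨2 * (C + ENNReal.ofReal R₀⁻¹ ^ 2 * C'), by finiteness, fun R hR hRR f ↦ ?_⟩
    have hpt : ∀ j y, ‖inner ℝ (R⁻¹ • y) m‖ₑ * ‖SchwartzMap.fourierMultiplierCLM ℂ
        (dyadicDilate b₀ b j) (localizeCLM χ hR f) y‖ₑ ≤
        ‖SchwartzMap.fourierMultiplierCLM ℂ (dyadicDilate b₀ b j)
          (localizeCLM (SchwartzMap.smulLeftCLM ℂ (inner ℝ · m) χ) hR f) y‖ₑ +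
        ENNReal.ofReal R₀⁻¹ * ‖SchwartzMap.fourierMultiplierCLM ℂ
          (dyadicDilate (∂_{m} b₀) (∂_{m} b) j) (localizeCLM χ hR f) y‖ₑ := fun j y ↦ by
      have h1 := inner_mul_fourierMultiplierCLM (dyadicDilate b₀ b j) (localizeCLM χ hR f) m y
      rw [smulLeftCLM_inner_localizeCLM, lineDeriv_dyadicDilate, fourierMultiplierCLM_real_smul,
        map_smul, smul_apply, smul_apply, smul_eq_mul, Complex.real_smul] at h1
      have hR' : (R : ℂ) ≠ 0 := by exact_mod_cast hR.ne'
      set A := SchwartzMap.fourierMultiplierCLM ℂ (dyadicDilate b₀ b j)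
        (localizeCLM (SchwartzMap.smulLeftCLM ℂ (inner ℝ · m) χ) hR f) y
      set B := SchwartzMap.fourierMultiplierCLM ℂ
        (dyadicDilate (∂_{m} b₀) (∂_{m} b) j) (localizeCLM χ hR f) y
      set κ : ℂ := (R : ℂ)⁻¹ * ((((2 : ℝ) ^ j)⁻¹ : ℝ) * (2 * Real.pi * Complex.I)⁻¹)
      have h2 : ((inner ℝ (R⁻¹ • y) m : ℝ) : ℂ) * SchwartzMap.fourierMultiplierCLM ℂ
          (dyadicDilate b₀ b j) (localizeCLM χ hR f) y = A - κ * B := by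
        rw [inner_smul_left, conj_trivial, Complex.ofReal_mul, mul_assoc, h1]
        simp only [κ]
        push_cast
        field_simp
      have h3 : ‖κ‖ ≤ R₀⁻¹ := by
        have h4 : ‖(2 * Real.pi * Complex.I)⁻¹‖ ≤ 1 := by
          rw [norm_inv]
          refine inv_le_one_of_one_le₀ ?_
          simp only [norm_mul, Complex.norm_I, Complex.norm_real, Complex.norm_ofNat, mul_one,
            Real.norm_of_nonneg Real.pi_pos.le]
          linarith [Real.pi_gt_three]
        simp only [κ, norm_mul, norm_inv, Complex.norm_real]
        rw [Real.norm_of_nonneg hR.le, Real.norm_of_nonneg (by positivity)]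
        rw [norm_inv, norm_mul, norm_mul, Complex.norm_real] at h4
        have h5 : ((2 : ℝ) ^ j)⁻¹ ≤ 1 := (inv_two_pow_mem_Icc j).2
        calc _ ≤ R₀⁻¹ * (1 * 1) := by gcongr
          _ = _ := by ring
      calc _ = ‖A - κ * B‖ₑ := by
            rw [← h2, enorm_mul, ← ofReal_norm ((_ : ℝ) : ℂ), Complex.norm_real, ofReal_norm]
        _ ≤ ‖A‖ₑ + ‖κ * B‖ₑ := enorm_sub_le
        _ ≤ _ := by
            rw [enorm_mul, ← ofReal_norm κ]
            gcongr
    have hm : ∀ (j : ℕ) (a g : 𝓢(Space d, ℂ)), Measurable fun y ↦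
        (ENNReal.ofReal (((2 : ℝ) ^ j) ^ s) * (‖inner ℝ (R⁻¹ • y) m‖ₑ ^ n *
          ‖SchwartzMap.fourierMultiplierCLM ℂ a g y‖ₑ)) ^ 2 := fun j a g ↦ by
      have h1 : Measurable fun y ↦ ‖SchwartzMap.fourierMultiplierCLM ℂ a g y‖ₑ :=
        (SchwartzMap.continuous _).enorm.measurable
      have h2 : Measurable fun y : Space d ↦ ‖(inner ℝ (R⁻¹ • y) m : ℝ)‖ₑ :=
        (by fun_prop : Continuous fun y : Space d ↦ (inner ℝ (R⁻¹ • y) m : ℝ)).enorm.measurable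
      exact (((h2.pow_const n).mul h1).const_mul _).pow_const 2
    have hsq : ∀ x y : ℝ≥0∞, (x + y) ^ 2 ≤ 2 * (x ^ 2 + y ^ 2) := fun x y ↦ by
      have := ENNReal.rpow_add_le_mul_rpow_add_rpow x y (p := 2) (by norm_num)
      norm_num at this
      exact_mod_cast this
    calc _ ≤ ∑' j, ∫⁻ y, 2 * ((ENNReal.ofReal (((2 : ℝ) ^ j) ^ s) *
          (‖inner ℝ (R⁻¹ • y) m‖ₑ ^ n * ‖SchwartzMap.fourierMultiplierCLM ℂ (dyadicDilate b₀ b j)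
          (localizeCLM (SchwartzMap.smulLeftCLM ℂ (inner ℝ · m) χ) hR f) y‖ₑ)) ^ 2 +
          ENNReal.ofReal R₀⁻¹ ^ 2 * (ENNReal.ofReal (((2 : ℝ) ^ j) ^ s) *
          (‖inner ℝ (R⁻¹ • y) m‖ₑ ^ n * ‖SchwartzMap.fourierMultiplierCLM ℂ
          (dyadicDilate (∂_{m} b₀) (∂_{m} b) j) (localizeCLM χ hR f) y‖ₑ)) ^ 2) := by
          refine ENNReal.tsum_le_tsum fun j ↦ lintegral_mono fun y ↦ ?_
          rw [pow_succ _ n, mul_assoc (_ ^ n)]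
          refine (pow_le_pow_left' (mul_le_mul_right (mul_le_mul_right (hpt j y) _) _) 2).trans ?_
          rw [mul_add, mul_add]
          refine (hsq _ _).trans (le_of_eq ?_)
          ring
      _ = 2 * ((∑' j, ∫⁻ y, (ENNReal.ofReal (((2 : ℝ) ^ j) ^ s) *
          (‖inner ℝ (R⁻¹ • y) m‖ₑ ^ n * ‖SchwartzMap.fourierMultiplierCLM ℂ (dyadicDilate b₀ b j)
          (localizeCLM (SchwartzMap.smulLeftCLM ℂ (inner ℝ · m) χ) hR f) y‖ₑ)) ^ 2) +
          ENNReal.ofReal R₀⁻¹ ^ 2 * ∑' j, ∫⁻ y, (ENNReal.ofReal (((2 : ℝ) ^ j) ^ s) *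
          (‖inner ℝ (R⁻¹ • y) m‖ₑ ^ n * ‖SchwartzMap.fourierMultiplierCLM ℂ
          (dyadicDilate (∂_{m} b₀) (∂_{m} b) j) (localizeCLM χ hR f) y‖ₑ)) ^ 2) := by
          rw [← ENNReal.tsum_mul_left (a := ENNReal.ofReal R₀⁻¹ ^ 2), ← ENNReal.tsum_add, ← ENNReal.tsum_mul_left]
          refine tsum_congr fun j ↦ ?_
          rw [lintegral_const_mul' _ _ (by finiteness), lintegral_add_left (hm _ _ _),
            lintegral_const_mul' _ _ (by finiteness)]
      _ ≤ 2 * (C * (∫⁻ ξ, (sobolevWeight s ξ * ‖𝓕 f ξ‖ₑ) ^ 2) + ENNReal.ofReal R₀⁻¹ ^ 2 *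
          (C' * ∫⁻ ξ, (sobolevWeight s ξ * ‖𝓕 f ξ‖ₑ) ^ 2)) := by
          gcongr
          · exact h R hR hRR f
          · exact h' R hR hRR f
      _ = _ := by ring

lemma ballWeight_ne_zero (z : Space d) : ballWeight z ≠ 0 := by
  rw [ballWeight, ne_eq, ENNReal.ofReal_eq_zero, not_le]
  positivity

lemma ballWeight_ne_top (z : Space d) : ballWeight z ≠ ⊤ := ENNReal.ofReal_ne_top

lemma ballWeight_le_one (z : Space d) : ballWeight z ≤ 1 := by
  rw [ballWeight, ENNReal.ofReal_le_one]
  exact inv_le_one_of_one_le₀ (one_le_pow₀ (by linarith [norm_nonneg z]))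

/-- The reciprocal weight is controlled by powers of the coordinates, which are the multiplications
that commute well with Fourier multipliers. -/
lemma ballWeight_inv_le (hd : 1 ≤ d) (z : Space d) : (ballWeight z)⁻¹ ≤
    ENNReal.ofReal (4 ^ d * d ^ d) *
      (1 + ∑ i, (‖inner ℝ z (EuclideanSpace.single i (1 : ℝ))‖ₑ ^ d) ^ 2) := by
  obtain ⟨n, rfl⟩ : ∃ n, d = n + 1 := ⟨d - 1, by omega⟩
  have h1 : ‖z‖ ^ (2 * (n + 1)) ≤ (n + 1 : ℕ) ^ n * ∑ i, (|z i| ^ (n + 1)) ^ 2 := by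
    have h := pow_sum_div_card_le_sum_pow (s := Finset.univ) (f := fun i ↦ |z i| ^ 2)
      (fun i _ ↦ by positivity) n
    rw [div_le_iff₀ (by simp; positivity), mul_comm, Finset.card_univ, Fintype.card_fin] at h
    calc ‖z‖ ^ (2 * (n + 1)) = (∑ i, |z i| ^ 2) ^ (n + 1) := by
          rw [pow_mul, EuclideanSpace.norm_sq_eq]; simp
      _ ≤ _ := h
      _ = _ := by simp_rw [← pow_mul, mul_comm]
  have h2 : (1 + ‖z‖) ^ (2 * (n + 1)) ≤
      4 ^ (n + 1) * ((n + 1 : ℕ) : ℝ) ^ (n + 1) * (1 + ∑ i, (|z i| ^ (n + 1)) ^ 2) := by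
    have hS : 0 ≤ ∑ i, (|z i| ^ (n + 1)) ^ 2 := by positivity
    have hn : (1 : ℝ) ≤ ((n + 1 : ℕ) : ℝ) := by exact_mod_cast Nat.succ_pos n
    calc (1 + ‖z‖) ^ (2 * (n + 1))
        ≤ 2 ^ (2 * (n + 1) - 1) * (1 ^ (2 * (n + 1)) + ‖z‖ ^ (2 * (n + 1))) :=
          add_pow_le zero_le_one (norm_nonneg z) _
      _ ≤ 4 ^ (n + 1) * (((n + 1 : ℕ) : ℝ) ^ (n + 1) * 1 +
          ((n + 1 : ℕ) : ℝ) ^ (n + 1) * ∑ i, (|z i| ^ (n + 1)) ^ 2) := by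
          have h3 : (2 : ℝ) ^ (2 * (n + 1) - 1) ≤ 4 ^ (n + 1) := by
            rw [show (4 : ℝ) = 2 ^ 2 by norm_num, ← pow_mul]
            exact pow_le_pow_right₀ one_le_two (by omega)
          have h4 : (1 : ℝ) ≤ ((n + 1 : ℕ) : ℝ) ^ (n + 1) := one_le_pow₀ hn
          have h5 : ((n + 1 : ℕ) : ℝ) ^ n ≤ ((n + 1 : ℕ) : ℝ) ^ (n + 1) :=
            pow_le_pow_right₀ hn (by omega)
          gcongr
          · rw [one_pow, mul_one]; exact h4
          · exact h1.trans (mul_le_mul_of_nonneg_right h5 hS)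
      _ = _ := by ring
  rw [ballWeight, ← ENNReal.ofReal_inv_of_pos (by positivity), inv_inv]
  refine (ENNReal.ofReal_le_ofReal h2).trans (le_of_eq ?_)
  rw [ENNReal.ofReal_mul (by positivity), ENNReal.ofReal_add zero_le_one (by positivity),
    ENNReal.ofReal_one, ENNReal.ofReal_sum_of_nonneg fun i _ ↦ by positivity]
  congr 2
  refine Finset.sum_congr rfl fun i _ ↦ ?_
  rw [ENNReal.ofReal_pow (by positivity), ENNReal.ofReal_pow (by positivity),
    EuclideanSpace.inner_single_right, ← ofReal_norm]
  simp

/-- The weighted square function estimate: the dyadic pieces of `χ(· / R) f` are concentrated in the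
ball of radius `R`. -/
lemma exists_tsum_lintegral_ballWeight_le (hd : 1 ≤ d) {s R₀ : ℝ} (hs : 0 ≤ s) (hR₀ : 0 < R₀)
    (b₀ : 𝓢(Space d, ℂ)) {b : 𝓢(Space d, ℂ)} (hb : IsRingSupported b) (χ : 𝓢(Space d, ℂ)) :
    ∃ C : ℝ≥0∞, C ≠ ⊤ ∧ ∀ (R : ℝ) (hR : 0 < R), R₀ ≤ R → ∀ f : 𝓢(Space d, ℂ),
      ∑' j, ENNReal.ofReal (((2 : ℝ) ^ j) ^ s) ^ 2 * ∫⁻ y, (ballWeight (R⁻¹ • y))⁻¹ *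
        ‖SchwartzMap.fourierMultiplierCLM ℂ (dyadicDilate b₀ b j) (localizeCLM χ hR f) y‖ₑ ^ 2 ≤
        C * ∫⁻ ξ, (sobolevWeight s ξ * ‖𝓕 f ξ‖ₑ) ^ 2 := by
  obtain ⟨C₀, hC₀, h₀⟩ := exists_tsum_lintegral_inner_pow_le hs hR₀ (0 : Space d) 0 b₀ hb χ
  choose C hC h using fun i : Fin d ↦ exists_tsum_lintegral_inner_pow_le hs hR₀
    (EuclideanSpace.single i (1 : ℝ)) d b₀ hb χ
  set A : ℝ≥0∞ := ENNReal.ofReal (4 ^ d * d ^ d)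
  have hA : A ≠ ⊤ := ENNReal.ofReal_ne_top
  refine ⟨A * (C₀ + ∑ i, C i), ENNReal.mul_ne_top hA (ENNReal.add_ne_top.2
    ⟨hC₀, ENNReal.sum_ne_top.2 fun i _ ↦ hC i⟩), fun R hR hRR f ↦ ?_⟩
  set w : ℕ → Space d → ℝ≥0∞ := fun j y ↦
    ‖SchwartzMap.fourierMultiplierCLM ℂ (dyadicDilate b₀ b j) (localizeCLM χ hR f) y‖ₑ with hw
  have hwm : ∀ j, Measurable (w j) := fun j ↦ (SchwartzMap.continuous _).enorm.measurable
  set P : ℕ → ℝ≥0∞ := fun j ↦ ENNReal.ofReal (((2 : ℝ) ^ j) ^ s)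
  have him : ∀ i : Fin d, Measurable fun y : Space d ↦
      ‖(inner ℝ (R⁻¹ • y) (EuclideanSpace.single i (1 : ℝ)) : ℝ)‖ₑ := fun i ↦
    (by fun_prop : Continuous fun y : Space d ↦
      (inner ℝ (R⁻¹ • y) (EuclideanSpace.single i (1 : ℝ)) : ℝ)).enorm.measurable
  have hsum : ∀ j, P j ^ 2 * ∫⁻ y, (ballWeight (R⁻¹ • y))⁻¹ * w j y ^ 2 ≤
      A * ((∫⁻ y, (P j * w j y) ^ 2) + ∑ i, ∫⁻ y, (P j *
        (‖inner ℝ (R⁻¹ • y) (EuclideanSpace.single i (1 : ℝ))‖ₑ ^ d * w j y)) ^ 2) := fun j ↦ by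
    rw [← lintegral_const_mul' _ _ (by simp only [P]; finiteness),
      ← lintegral_finsetSum _ fun i _ ↦ by
        exact ((((him i).pow_const d).mul (hwm j)).const_mul _).pow_const 2,
      ← lintegral_add_left (((hwm j).const_mul _).pow_const 2), ← lintegral_const_mul' _ _ hA]
    refine lintegral_mono fun y ↦ ?_
    calc _ ≤ P j ^ 2 * ((A * (1 + ∑ i, (‖inner ℝ (R⁻¹ • y)
          (EuclideanSpace.single i (1 : ℝ))‖ₑ ^ d) ^ 2)) * w j y ^ 2) := by
          gcongr
          exact ballWeight_inv_le hd _
      _ = A * ((P j * w j y) ^ 2 + (∑ i, (‖inner ℝ (R⁻¹ • y)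
          (EuclideanSpace.single i (1 : ℝ))‖ₑ ^ d) ^ 2) * (P j * w j y) ^ 2) := by ring
      _ = _ := by
          rw [Finset.sum_mul]
          congr 2
          exact Finset.sum_congr rfl fun i _ ↦ by ring
  have h₀' := h₀ R hR hRR f
  simp only [pow_zero, one_mul] at h₀'
  refine (ENNReal.tsum_le_tsum hsum).trans ?_
  rw [ENNReal.tsum_mul_left, ENNReal.tsum_add, Summable.tsum_finsetSum fun i _ ↦ ENNReal.summable,
    mul_assoc, add_mul, Finset.sum_mul]
  gcongr with i
  exact h i R hR hRR f

/-! ### The dyadic pieces of the localized flow -/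

/-- The kernels are radial, since their symbols are invariant under reflections. -/
lemma fourierInv_kernelSymbol_congr (α t : ℝ) (j : ℕ) {z w : Space d} (h : ‖z‖ = ‖w‖) :
    𝓕⁻ (kernelSymbol α t j) z = 𝓕⁻ (kernelSymbol α t j) w := by
  set L := Submodule.reflection (ℝ ∙ (z - w))ᗮ
  have hL : L z = w := Submodule.reflection_sub h
  have hk : (kernelSymbol α t j : Space d → ℂ) ∘ L = kernelSymbol α t j := by
    ext ξ
    have h1 : ‖(2 * Real.pi) • L ξ‖ = ‖(2 * Real.pi) • ξ‖ := by
      rw [norm_smul, norm_smul, L.norm_map]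
    rw [Function.comp_apply, kernelSymbol, flowSymbol_apply, flowSymbol_apply, bracket, bracket, h1,
      kernelCutoff_congr j (L.norm_map ξ)]
  rw [SchwartzMap.fourierInv_coe, ← hL, ← Real.fourierInv_comp_linearIsometry, hk]

/-- Combines the `L²` bound, the better one for `|t| ≤ R`, with the decay bound, the better one for
`|t| ≥ R`, into a power of `⟨t / R⟩`; the constant comes from `⟨t / R⟩ ≤ 1 + |t| / R`. -/
lemma bracket_rpow_bound (hd : 1 ≤ d) {t R : ℝ} (hR : 0 < R) {x : ℝ≥0∞} {A B : ℝ≥0∞}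
    (h1 : x ≤ A)
    (h2 : ENNReal.ofReal (|t| ^ (d - 1)) * x ≤ B * ENNReal.ofReal (R ^ (d - 1))) :
    x ≤ ENNReal.ofReal (2 ^ (d - 1)) * (A + B) *
      ENNReal.ofReal (bracket (t / R) ^ (1 - (d : ℝ))) := by
  have hb := bracket_pos (t / R)
  have h3 : bracket (t / R) ^ (1 - (d : ℝ)) = (bracket (t / R) ^ (d - 1))⁻¹ := by
    rw [← Real.rpow_natCast, ← Real.rpow_neg hb.le, Nat.cast_sub hd]
    norm_num
  have h4 : bracket (t / R) ≤ 1 + |t| / R := by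
    rw [bracket, Real.sqrt_le_left (by positivity), Real.norm_eq_abs, abs_div, abs_of_pos hR]
    nlinarith [div_nonneg (abs_nonneg t) hR.le]
  have h5 : x * ENNReal.ofReal (bracket (t / R) ^ (d - 1)) ≤
      ENNReal.ofReal (2 ^ (d - 1)) * (A + B) := by
    rcases le_total |t| R with h | h
    · have h6 : bracket (t / R) ≤ 2 := by
        have : |t| / R ≤ 1 := (div_le_one hR).2 h
        linarith
      calc _ ≤ A * ENNReal.ofReal (2 ^ (d - 1)) := by gcongr
        _ ≤ _ := by
          rw [mul_comm]
          gcongr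
          exact le_self_add
    · have h6 : bracket (t / R) ≤ 2 * |t| * R⁻¹ := by
        have : 1 ≤ |t| / R := (one_le_div hR).2 h
        have h7 : |t| / R = |t| * R⁻¹ := div_eq_mul_inv _ _
        linarith
      calc _ ≤ x * ENNReal.ofReal ((2 * |t| * R⁻¹) ^ (d - 1)) := by gcongr
        _ = ENNReal.ofReal (2 ^ (d - 1)) * ((ENNReal.ofReal (|t| ^ (d - 1)) * x) *
            ENNReal.ofReal (R⁻¹ ^ (d - 1))) := by
          rw [mul_pow, mul_pow, ENNReal.ofReal_mul (by positivity),
            ENNReal.ofReal_mul (by positivity)]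
          ring
        _ ≤ ENNReal.ofReal (2 ^ (d - 1)) * ((B * ENNReal.ofReal (R ^ (d - 1))) *
            ENNReal.ofReal (R⁻¹ ^ (d - 1))) := by gcongr
        _ = ENNReal.ofReal (2 ^ (d - 1)) * B := by
          rw [mul_assoc, ← ENNReal.ofReal_mul (by positivity), ← mul_pow,
            mul_inv_cancel₀ hR.ne', one_pow, ENNReal.ofReal_one, mul_one]
        _ ≤ _ := by
          gcongr
          exact le_add_self
  rw [h3, ENNReal.ofReal_inv_of_pos (by positivity), ← div_eq_mul_inv]
  rw [ENNReal.le_div_iff_mul_le (Or.inl (by rw [ne_eq, ENNReal.ofReal_eq_zero, not_le]; positivity))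
    (Or.inl ENNReal.ofReal_ne_top)]
  exact h5

/-- The mass of the dyadic kernels in a ball of radius `R`. -/
lemma exists_lintegral_kernel_ballWeight_le (hd : 1 ≤ d) {α : ℝ} (hα : 0 ≤ α) :
    ∃ C : ℝ≥0∞, C ≠ ⊤ ∧ ∀ (R : ℝ), 0 < R → ∀ (t : ℝ) (j : ℕ) (x : Space d),
      ∫⁻ y, ‖𝓕⁻ (kernelSymbol α t j) (x - y)‖ₑ ^ 2 * ballWeight (R⁻¹ • y) ≤
        C * ENNReal.ofReal (bracket (t / R) ^ (1 - (d : ℝ))) *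
          ENNReal.ofReal (((2 : ℝ) ^ j) ^ ((d : ℝ) - 2 * α)) := by
  obtain ⟨M, hM, h⟩ := exists_lintegral_kernel_le (d := d) hα
  obtain ⟨M', hM', h'⟩ := exists_lintegral_radialWeight_kernel_le hd hα
  obtain ⟨K, hK, hrad⟩ := exists_lintegral_radial_le (d := d) hd
  refine ⟨ENNReal.ofReal (2 ^ (d - 1)) * (M + K * M'), by finiteness, fun R hR t j x ↦ ?_⟩
  set P := ENNReal.ofReal (((2 : ℝ) ^ j) ^ ((d : ℝ) - 2 * α))
  have hm : Measurable fun z : Space d ↦ ‖𝓕⁻ (kernelSymbol α t j) z‖ₑ ^ 2 :=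
    ((SchwartzMap.continuous _).enorm.measurable).pow_const 2
  refine (bracket_rpow_bound (t := t) hd hR (A := M * P) (B := K * M' * P) ?_ ?_).trans
    (le_of_eq (by ring))
  · calc _ ≤ ∫⁻ y, ‖𝓕⁻ (kernelSymbol α t j) (x - y)‖ₑ ^ 2 :=
          lintegral_mono fun y ↦ mul_le_of_le_one_right' (ballWeight_le_one _)
      _ = ∫⁻ y, ‖𝓕⁻ (kernelSymbol α t j) y‖ₑ ^ 2 :=
          lintegral_sub_left_eq_self (fun y ↦ ‖𝓕⁻ (kernelSymbol α t j) y‖ₑ ^ 2) x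
      _ ≤ _ := h t j
  · have h1 := hrad _ hm (fun z w hzw ↦ by rw [fourierInv_kernelSymbol_congr α t j hzw]) R hR x
    calc _ ≤ ENNReal.ofReal (|t| ^ (d - 1)) * (K * (ENNReal.ofReal (R ^ (d - 1)) *
          ∫⁻ z, ‖𝓕⁻ (kernelSymbol α t j) z‖ₑ ^ 2 * radialWeight z)) := by gcongr
      _ = K * ENNReal.ofReal (R ^ (d - 1)) * (ENNReal.ofReal (|t| ^ (d - 1)) *
          ∫⁻ z, ‖𝓕⁻ (kernelSymbol α t j) z‖ₑ ^ 2 * radialWeight z) := by ring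
      _ ≤ K * ENNReal.ofReal (R ^ (d - 1)) * (M' * P) := by
          exact mul_le_mul_right (h' t j) _
      _ = _ := by ring

/-- A Fourier multiplier with Schwartz symbol is the convolution with the inverse Fourier transform
of the symbol. -/
lemma fourierMultiplierCLM_apply_eq_integral (k w : 𝓢(Space d, ℂ)) (x : Space d) :
    SchwartzMap.fourierMultiplierCLM ℂ k w x = ∫ y, w y * 𝓕⁻ k (x - y) := by
  have h := SchwartzMap.convolution_apply (ContinuousLinearMap.mul ℂ ℂ) w (𝓕⁻ k) x
  rw [MeasureTheory.convolution] at h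
  simp only [ContinuousLinearMap.mul_apply'] at h
  rw [← h, SchwartzMap.fourierMultiplierCLM_apply]
  have h2 : SchwartzMap.convolution (ContinuousLinearMap.mul ℂ ℂ) w (𝓕⁻ k) =
      𝓕⁻ (SchwartzMap.pairing (ContinuousLinearMap.mul ℂ ℂ) (𝓕 w) (𝓕 (𝓕⁻ k))) := rfl
  rw [h2, fourier_fourierInv_eq]
  congr 2
  ext ξ
  rw [SchwartzMap.smulLeftCLM_apply_apply k.hasTemperateGrowth, SchwartzMap.pairing_apply_apply,
    ContinuousLinearMap.mul_apply', smul_eq_mul, mul_comm]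

/-- The symbol `ψ` of the lowest Littlewood-Paley block, as a function of `ξ / 2π`. -/
def lowBlock {ψ : Space d → ℝ} (hψ : IsCutoff ψ) : 𝓢(Space d, ℂ) :=
  HasCompactSupport.toSchwartzMap (f := fun ξ ↦ ((ψ ((2 * Real.pi) • ξ) : ℝ) : ℂ))
    (HasCompactSupport.intro (isCompact_closedBall 0 2) fun ξ hξ ↦ by
      rw [hψ.eq_zero, Complex.ofReal_zero]
      rw [mem_closedBall_zero_iff, not_le] at hξ
      rw [norm_smul, Real.norm_of_nonneg (by positivity)]
      nlinarith [Real.pi_gt_three])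
    (Complex.ofRealCLM.contDiff.comp (hψ.smooth.comp (contDiff_const_smul _)))

lemma lowBlock_apply {ψ : Space d → ℝ} (hψ : IsCutoff ψ) (ξ : Space d) :
    lowBlock hψ ξ = ((ψ ((2 * Real.pi) • ξ) : ℝ) : ℂ) := rfl

/-- The symbol `ψ(ξ) - ψ(2ξ)` of the other Littlewood-Paley blocks, as a function of `ξ / 2π`. -/
def ringBlock {ψ : Space d → ℝ} (hψ : IsCutoff ψ) : 𝓢(Space d, ℂ) :=
  lowBlock hψ - dilate two_ne_zero (lowBlock hψ)

lemma isRingSupported_ringBlock {ψ : Space d → ℝ} (hψ : IsCutoff ψ) :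
    IsRingSupported (ringBlock hψ) := by
  have hpi := Real.pi_pos
  refine ⟨1 / (4 * Real.pi), by positivity, 2 / (2 * Real.pi), fun ξ hξ ↦ ?_⟩
  by_contra h
  apply hξ
  rw [ringBlock, sub_apply, dilate_apply, lowBlock_apply, lowBlock_apply]
  have h1 : ‖(2 * Real.pi) • ξ‖ = 2 * Real.pi * ‖ξ‖ := by
    rw [norm_smul, Real.norm_of_nonneg (by positivity)]
  have h2 : ‖(2 * Real.pi) • (2 : ℝ) • ξ‖ = 4 * Real.pi * ‖ξ‖ := by
    rw [norm_smul_two_pi_smul (by norm_num), h1]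
    ring
  have h0 := mul_nonneg hpi.le (norm_nonneg ξ)
  rw [not_and_or, not_le, not_le, lt_div_iff₀ (by positivity), div_lt_iff₀ (by positivity)] at h
  rcases h with h | h
  · rw [hψ.eq_one _ (by rw [h1]; linarith), hψ.eq_one _ (by rw [h2]; linarith), sub_self]
  · rw [hψ.eq_zero _ (by rw [h1]; linarith), hψ.eq_zero _ (by rw [h2]; linarith), sub_self]

lemma dyadicDilate_lowBlock_ringBlock {ψ : Space d → ℝ} (hψ : IsCutoff ψ) (j : ℕ) (ξ : Space d) :
    dyadicDilate (lowBlock hψ) (ringBlock hψ) j ξ =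
      ((dyadicSymbol ψ j ((2 * Real.pi) • ξ) : ℝ) : ℂ) := by
  cases j with
  | zero => rfl
  | succ j =>
    have h : (2 : ℝ) • ((2 : ℝ) ^ (j + 1))⁻¹ • ξ = ((2 : ℝ) ^ j)⁻¹ • ξ := by
      rw [smul_smul]
      congr 1
      rw [pow_succ]
      field_simp
    rw [dyadicDilate, dilate_apply, ringBlock, sub_apply, dilate_apply, lowBlock_apply,
      lowBlock_apply, h, dyadicSymbol, Complex.ofReal_sub, smul_comm, smul_comm (2 * Real.pi)]

lemma hasTemperateGrowth_dyadicSymbol {ψ : Space d → ℝ} (hψ : IsCutoff ψ) (j : ℕ) :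
    (fun ξ : Space d ↦ ((dyadicSymbol ψ j ((2 * Real.pi) • ξ) : ℝ) : ℂ)).HasTemperateGrowth := by
  have h := (dyadicDilate (lowBlock hψ) (ringBlock hψ) j).hasTemperateGrowth
  rwa [funext (dyadicDilate_lowBlock_ringBlock hψ j)] at h

/-- The operator `P_j e^{it⟨∇⟩} ⟨∇⟩^{-α} χ(· / R)` on Schwartz functions. -/
def localizedFlow (ψ : Space d → ℝ) (α t : ℝ) (χ : 𝓢(Space d, ℂ)) {R : ℝ} (hR : 0 < R) (j : ℕ) :
    𝓢(Space d, ℂ) →L[ℂ] 𝓢(Space d, ℂ) :=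
  SchwartzMap.fourierMultiplierCLM ℂ
      (fun ξ ↦ ((dyadicSymbol ψ j ((2 * Real.pi) • ξ) : ℝ) : ℂ)) ∘L
    SchwartzMap.fourierMultiplierCLM ℂ
      (fun ξ ↦ Complex.exp (Complex.I * ((t * bracket ((2 * Real.pi) • ξ) : ℝ) : ℂ))) ∘L
    SchwartzMap.fourierMultiplierCLM ℂ
      (fun ξ ↦ ((bracket ((2 * Real.pi) • ξ) ^ (-α) : ℝ) : ℂ)) ∘L localizeCLM χ hR

lemma localizedFlow_apply {ψ : Space d → ℝ} (hψ : IsCutoff ψ) (α t : ℝ) (χ : 𝓢(Space d, ℂ)) {R : ℝ}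
    (hR : 0 < R) (j : ℕ) (f : 𝓢(Space d, ℂ)) : localizedFlow ψ α t χ hR j f =
      SchwartzMap.fourierMultiplierCLM ℂ (kernelSymbol α t j) (SchwartzMap.fourierMultiplierCLM ℂ
        (dyadicDilate (lowBlock hψ) (ringBlock hψ) j) (localizeCLM χ hR f)) := by
  have h1 := hasTemperateGrowth_dyadicSymbol hψ j
  have h2 := hasTemperateGrowth_propagator (d := d) t (2 * Real.pi)
  have h3 := hasTemperateGrowth_bracket_rpow (d := d) (-α) (2 * Real.pi)
  simp only [localizedFlow, ContinuousLinearMap.comp_apply]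
  rw [SchwartzMap.fourierMultiplierCLM_fourierMultiplierCLM_apply h2 h3,
    SchwartzMap.fourierMultiplierCLM_fourierMultiplierCLM_apply h1 (h2.mul h3),
    SchwartzMap.fourierMultiplierCLM_fourierMultiplierCLM_apply
      (SchwartzMap.hasTemperateGrowth _) (SchwartzMap.hasTemperateGrowth _)]
  congr 2
  ext ξ
  have h := dyadicSymbol_mul_kernelCutoff hψ j ξ
  simp only [Pi.mul_apply]
  rw [dyadicDilate_lowBlock_ringBlock, kernelSymbol, flowSymbol_apply]
  nth_rewrite 1 [← h]
  push_cast
  ring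

/-- The dispersive estimate on Schwartz functions: each dyadic piece is the convolution of a kernel
with a localized function, and Cauchy-Schwarz with respect to the weight `ballWeight (· / R)`
separates the decay of the kernels from the square function of `χ(· / R) f`. -/
lemma exists_tsum_localizedFlow_le (hd : 1 ≤ d) {ψ : Space d → ℝ} (hψ : IsCutoff ψ)
    (χ : 𝓢(Space d, ℂ)) {α R₀ : ℝ} (hα : 0 ≤ α) (hα' : α ≤ d / 2) (hR₀ : 0 < R₀) :
    ∃ C : ℝ≥0∞, C ≠ ⊤ ∧ ∀ (R : ℝ) (hR : 0 < R), R₀ ≤ R → ∀ (t : ℝ) (f : 𝓢(Space d, ℂ)),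
      ∑' j, (⨆ x, ‖localizedFlow ψ α t χ hR j f x‖ₑ) ^ 2 ≤
        C * ENNReal.ofReal (bracket (t / R) ^ (1 - (d : ℝ))) *
          ∫⁻ ξ, (sobolevWeight ((d : ℝ) / 2 - α) ξ * ‖𝓕 f ξ‖ₑ) ^ 2 := by
  obtain ⟨C, hC, h⟩ := exists_lintegral_kernel_ballWeight_le hd hα
  obtain ⟨C', hC', h'⟩ := exists_tsum_lintegral_ballWeight_le hd (sub_nonneg.2 hα') hR₀
    (lowBlock hψ) (isRingSupported_ringBlock hψ) χ
  refine ⟨C * C', by finiteness, fun R hR hRR t f ↦ ?_⟩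
  set w : ℕ → 𝓢(Space d, ℂ) := fun j ↦ SchwartzMap.fourierMultiplierCLM ℂ
    (dyadicDilate (lowBlock hψ) (ringBlock hψ) j) (localizeCLM χ hR f)
  set D := ENNReal.ofReal (bracket (t / R) ^ (1 - (d : ℝ)))
  have hpt : ∀ j, (⨆ x, ‖localizedFlow ψ α t χ hR j f x‖ₑ) ^ 2 ≤ C * D *
      (ENNReal.ofReal (((2 : ℝ) ^ j) ^ ((d : ℝ) / 2 - α)) ^ 2 *
        ∫⁻ y, (ballWeight (R⁻¹ • y))⁻¹ * ‖w j y‖ₑ ^ 2) := fun j ↦ by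
    have hk : Measurable fun z : Space d ↦ ‖𝓕⁻ (kernelSymbol α t j) z‖ₑ ^ 2 :=
      ((SchwartzMap.continuous _).enorm.measurable).pow_const 2
    have hb : Measurable fun y : Space d ↦ ballWeight (R⁻¹ • y) :=
      measurable_ballWeight.comp (measurable_const_smul _)
    have hwm : Measurable fun y ↦ ‖w j y‖ₑ ^ 2 :=
      ((SchwartzMap.continuous _).enorm.measurable).pow_const 2
    have h2 : ENNReal.ofReal (((2 : ℝ) ^ j) ^ ((d : ℝ) - 2 * α)) =
        ENNReal.ofReal (((2 : ℝ) ^ j) ^ ((d : ℝ) / 2 - α)) ^ 2 := by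
      rw [← ENNReal.ofReal_pow (by positivity), ← Real.rpow_natCast _ 2,
        ← Real.rpow_mul (by positivity)]
      congr 2
      push_cast
      ring
    rw [ENNReal.iSup_pow]
    refine iSup_le fun x ↦ ?_
    rw [localizedFlow_apply hψ, fourierMultiplierCLM_apply_eq_integral]
    calc _ ≤ (∫⁻ y, ‖w j y * 𝓕⁻ (kernelSymbol α t j) (x - y)‖ₑ) ^ 2 := by
          gcongr
          exact enorm_integral_le_lintegral_enorm _
      _ ≤ (∫⁻ y, ‖𝓕⁻ (kernelSymbol α t j) (x - y)‖ₑ ^ 2 * ballWeight (R⁻¹ • y)) *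
          ∫⁻ y, (ballWeight (R⁻¹ • y))⁻¹ * ‖w j y‖ₑ ^ 2 := by
          refine lintegral_sq_le (((hk.comp (measurable_const.sub measurable_id)).mul
            hb).aemeasurable) (hb.inv.mul hwm).aemeasurable fun y ↦ le_of_eq ?_
          have h3 := ENNReal.mul_inv_cancel (ballWeight_ne_zero (R⁻¹ • y)) (ballWeight_ne_top _)
          calc _ = ‖𝓕⁻ (kernelSymbol α t j) (x - y)‖ₑ ^ 2 * 1 * ‖w j y‖ₑ ^ 2 := by
                rw [enorm_mul]; ring
            _ = _ := by
                rw [← h3]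
                ring
      _ ≤ _ := by
          refine (mul_le_mul_left (h R hR t j x) _).trans (le_of_eq ?_)
          rw [h2]
          ring
  refine (ENNReal.tsum_le_tsum hpt).trans ?_
  rw [ENNReal.tsum_mul_left]
  refine (mul_le_mul_right (h' R hR hRR f) _).trans (le_of_eq ?_)
  ring

/-! ### From Schwartz functions to tempered distributions -/

/-- A square function estimate `L² → ℓ²(L^∞)` on Schwartz functions extends to `L²` by density. -/
lemma tsum_lpNorm_top_le {S : ℕ → 𝓢(Space d, ℂ) →L[ℂ] 𝓢(Space d, ℂ)}
    {S' : ℕ → 𝓢'(Space d, ℂ) →L[ℂ] 𝓢'(Space d, ℂ)}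
    (hSS' : ∀ (j : ℕ) (h : 𝓢(Space d, ℂ)), S' j (h : 𝓢'(Space d, ℂ)) = S j h)
    {A : ℝ≥0∞} (hA : A ≠ ⊤)
    (hS : ∀ h : 𝓢(Space d, ℂ), ∑' j, (⨆ x, ‖S j h x‖ₑ) ^ 2 ≤ A * eLpNorm h 2 volume ^ 2)
    (g : Lp ℂ 2 (volume : Measure (Space d))) :
    ∑' j, lpNorm ⊤ (S' j (g : 𝓢'(Space d, ℂ))) ^ 2 ≤ A * ‖g‖ₑ ^ 2 := by
  set e : 𝓢(Space d, ℂ) →ₗ[ℂ] Lp ℂ 2 (volume : Measure (Space d)) :=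
    (SchwartzMap.toLpCLM ℂ ℂ 2 volume).toLinearMap
  set T : ℕ → 𝓢(Space d, ℂ) →ₗ[ℂ] Lp ℂ ⊤ (volume : Measure (Space d)) := fun j ↦
    (SchwartzMap.toLpCLM ℂ ℂ ⊤ volume ∘L S j).toLinearMap
  have he : DenseRange e := SchwartzMap.denseRange_toLpCLM (F := ℂ) ENNReal.ofNat_ne_top
  have hT : ∀ j h, ‖T j h‖ₑ ≤ ⨆ x, ‖S j h x‖ₑ := fun j h ↦ by
    have h1 : ‖T j h‖ₑ = eLpNorm (S j h) ⊤ volume := Lp.enorm_toLp ((S j h).memLp ⊤ volume)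
    rw [h1, eLpNorm_exponent_top]
    exact eLpNormEssSup_le_of_ae_enorm_bound (Filter.Eventually.of_forall fun x ↦
      le_iSup (fun x ↦ ‖S j h x‖ₑ) x)
  have hsum : ∀ (J : ℕ) h, ∑ j ∈ Finset.range J, ‖T j h‖ₑ ^ 2 ≤ A * ‖e h‖ₑ ^ 2 := fun J h ↦ by
    have h1 : ‖e h‖ₑ = eLpNorm h 2 volume := Lp.enorm_toLp (h.memLp 2 volume)
    rw [h1]
    refine le_trans ?_ (hS h)
    refine (Finset.sum_le_sum fun j _ ↦ pow_le_pow_left' (hT j h) 2).trans ?_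
    exact ENNReal.sum_le_tsum _
  have hnorm : ∀ j, ∃ C, ∀ h, ‖T j h‖ ≤ C * ‖e h‖ := fun j ↦ ⟨√A.toReal, fun h ↦ by
    have h1 : ‖T j h‖ₑ ^ 2 ≤ A * ‖e h‖ₑ ^ 2 :=
      (Finset.single_le_sum (f := fun j ↦ ‖T j h‖ₑ ^ 2) (fun _ _ ↦ zero_le)
        (Finset.self_mem_range_succ j)).trans (hsum (j + 1) h)
    have h2 := ENNReal.toReal_mono (by finiteness) h1
    simp only [ENNReal.toReal_pow, ENNReal.toReal_mul, toReal_enorm] at h2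
    rw [← Real.sqrt_sq (norm_nonneg (e h)), ← Real.sqrt_mul (by positivity)]
    exact Real.le_sqrt_of_sq_le h2⟩
  set L : ℕ → Lp ℂ 2 (volume : Measure (Space d)) →L[ℂ] Lp ℂ ⊤ (volume : Measure (Space d)) :=
    fun j ↦ (T j).extendOfNorm e
  have hL : ∀ j h, L j (e h) = T j h := fun j h ↦ LinearMap.extendOfNorm_eq he (hnorm j) h
  have h1 : ∀ j, ((L j g : Lp ℂ ⊤ (volume : Measure (Space d))) : 𝓢'(Space d, ℂ)) =
      S' j (g : 𝓢'(Space d, ℂ)) := fun j ↦ by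
    have hc : Continuous fun g ↦ Lp.toTemperedDistributionCLM ℂ (volume : Measure (Space d)) ⊤
        (L j g) := (Lp.toTemperedDistributionCLM ℂ volume ⊤).continuous.comp (L j).continuous
    have hc' : Continuous fun g ↦ S' j
        (Lp.toTemperedDistributionCLM ℂ (volume : Measure (Space d)) 2 g) :=
      (S' j).continuous.comp (Lp.toTemperedDistributionCLM ℂ volume 2).continuous
    refine he.induction ?_ (isClosed_eq hc hc') g
    rintro _ ⟨h, rfl⟩
    rw [hL]
    change ((((S j h).toLp ⊤ volume : Lp ℂ ⊤ (volume : Measure (Space d)))) : 𝓢'(Space d, ℂ)) =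
      S' j ((h.toLp 2 volume : Lp ℂ 2 (volume : Measure (Space d))) : 𝓢'(Space d, ℂ))
    rw [Lp.toTemperedDistribution_toLp_eq, Lp.toTemperedDistribution_toLp_eq, hSS']
  have h2 : ∀ J, ∑ j ∈ Finset.range J, ‖L j g‖ₑ ^ 2 ≤ A * ‖g‖ₑ ^ 2 := fun J ↦ by
    refine he.induction ?_ (isClosed_le (f := fun g ↦ ∑ j ∈ Finset.range J, ‖L j g‖ₑ ^ 2)
      (g := fun g ↦ A * ‖g‖ₑ ^ 2) ?_ ?_) g
    · rintro _ ⟨h, rfl⟩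
      simp_rw [hL]
      exact hsum J h
    · exact continuous_finsetSum _ fun j _ ↦ (ENNReal.continuous_pow 2).comp
        (L j).continuous.enorm
    · exact (ENNReal.continuous_const_mul hA).comp ((ENNReal.continuous_pow 2).comp
        continuous_enorm)
  refine ENNReal.tsum_le_of_sum_range_le fun J ↦ le_trans ?_ (h2 J)
  exact Finset.sum_le_sum fun j _ ↦ pow_le_pow_left' (iInf₂_le (L j g) (h1 j)) 2

lemma localize_coe (χ : 𝓢(Space d, ℂ)) {R : ℝ} (hR : 0 < R) (f : 𝓢(Space d, ℂ)) :
    localize χ R (f : 𝓢'(Space d, ℂ)) = localizeCLM χ hR f := by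
  have h : (fun x ↦ χ (R⁻¹ • x)).HasTemperateGrowth :=
    (dilate (inv_ne_zero hR.ne') χ).hasTemperateGrowth
  ext u
  rw [localize, TemperedDistribution.smulLeftCLM_apply_apply, SchwartzMap.coe_apply,
    SchwartzMap.coe_apply]
  refine integral_congr_ae (Filter.Eventually.of_forall fun x ↦ ?_)
  simp only [SchwartzMap.smulLeftCLM_apply_apply h, localizeCLM_apply, smul_eq_mul]
  ring

lemma multiplier_coe {m : Space d → ℂ}
    (hm : (fun ξ ↦ m ((2 * Real.pi) • ξ)).HasTemperateGrowth) (f : 𝓢(Space d, ℂ)) :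
    multiplier m (f : 𝓢'(Space d, ℂ)) =
      SchwartzMap.fourierMultiplierCLM ℂ (fun ξ ↦ m ((2 * Real.pi) • ξ)) f :=
  TemperedDistribution.fourierMultiplierCLM_toTemperedDistributionCLM_eq hm f

lemma bracketNabla_coe (s : ℝ) (f : 𝓢(Space d, ℂ)) :
    bracketNabla s (f : 𝓢'(Space d, ℂ)) = SchwartzMap.fourierMultiplierCLM ℂ
      (fun ξ ↦ ((bracket ((2 * Real.pi) • ξ) ^ s : ℝ) : ℂ)) f :=
  multiplier_coe (hasTemperateGrowth_bracket_rpow _ _) f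

lemma bracketNabla_neg_bracketNabla (s : ℝ) (f : 𝓢'(Space d, ℂ)) :
    bracketNabla (-s) (bracketNabla s f) = f := by
  rw [bracketNabla, bracketNabla, multiplier, multiplier,
    TemperedDistribution.fourierMultiplierCLM_fourierMultiplierCLM_apply
      (hasTemperateGrowth_bracket_rpow _ _) (hasTemperateGrowth_bracket_rpow _ _)]
  have h : ((fun ξ : Space d ↦ ((bracket ((2 * Real.pi) • ξ) ^ s : ℝ) : ℂ)) *
      fun ξ ↦ ((bracket ((2 * Real.pi) • ξ) ^ (-s) : ℝ) : ℂ)) = fun _ ↦ 1 := by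
    ext ξ
    simp only [Pi.mul_apply]
    rw [← Complex.ofReal_mul, ← Real.rpow_add (bracket_pos _), add_neg_cancel, Real.rpow_zero,
      Complex.ofReal_one]
  rw [h, TemperedDistribution.fourierMultiplierCLM_const]
  simp

/-- `⟨∇⟩^{-s}` maps `L²` isometrically to `H^s`. -/
lemma lintegral_sobolevWeight_fourierMultiplierCLM (s : ℝ) (h : 𝓢(Space d, ℂ)) :
    ∫⁻ ξ, (sobolevWeight s ξ * ‖𝓕 (SchwartzMap.fourierMultiplierCLM ℂ
      (fun ξ ↦ ((bracket ((2 * Real.pi) • ξ) ^ (-s) : ℝ) : ℂ)) h) ξ‖ₑ) ^ 2 =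
      eLpNorm h 2 volume ^ 2 := by
  rw [eLpNorm_two_sq, ← lintegral_enorm_sq_fourier]
  refine lintegral_congr fun ξ ↦ ?_
  rw [SchwartzMap.fourierMultiplierCLM_apply, fourier_fourierInv_eq,
    SchwartzMap.smulLeftCLM_apply_apply (hasTemperateGrowth_bracket_rpow _ _), enorm_smul,
    ← mul_assoc]
  have hb := bracket_pos ((2 * Real.pi) • ξ)
  have h1 : sobolevWeight s ξ * ‖((bracket ((2 * Real.pi) • ξ) ^ (-s) : ℝ) : ℂ)‖ₑ = 1 := by
    rw [sobolevWeight, ← ofReal_norm, Complex.norm_real,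
      Real.norm_of_nonneg (Real.rpow_nonneg hb.le _), ← ENNReal.ofReal_mul (by positivity),
      ← Real.rpow_add hb, add_neg_cancel, Real.rpow_zero, ENNReal.ofReal_one]
  rw [h1, one_mul]

end KG

end

/-- Decay of the localized free Klein-Gordon propagator from `H^{d/2-α}` to `B^0_{∞,2}`. -/
theorem lemma3p5 (d : ℕ) (hd : 1 ≤ d)
    -- the Littlewood-Paley decomposition defining the Besov norm
    (ψ : KG.Space d → ℝ) (hψ : KG.IsCutoff ψ)
    (χ : 𝓢(KG.Space d, ℂ)) (α : ℝ) (hα : α ∈ Set.Icc (0 : ℝ) ((d : ℝ) / 2))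
    -- `R ≳ 1` means `R ≥ R₀` for an arbitrary fixed `R₀ > 0`
    (R₀ : ℝ) (hR₀ : 0 < R₀) :
    ∃ C : ℝ, 0 < C ∧ ∀ R : ℝ, R₀ ≤ R → ∀ t : ℝ, ∀ f : 𝓢'(KG.Space d, ℂ),
      TemperedDistribution.MemSobolev ((d : ℝ) / 2 - α) 2 f →
      KG.besovNorm ψ 0 ∞ 2
          (KG.propagator t (KG.bracketNabla (-α) (KG.localize χ R f)))
        ≤ ENNReal.ofReal (C * KG.bracket (t / R) ^ ((1 - (d : ℝ)) / 2))
          * KG.sobolevNorm ((d : ℝ) / 2 - α) f := by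
  obtain ⟨A, hA, h⟩ := KG.exists_tsum_localizedFlow_le hd hψ χ hα.1 hα.2 hR₀
  -- the summand `1` only makes the constant positive
  refine ⟨√(A.toReal + 1), by positivity, fun R hRR t f _ ↦ ?_⟩
  have hR : 0 < R := hR₀.trans_le hRR
  have hb := KG.bracket_pos (t / R)
  set s := (d : ℝ) / 2 - α
  set D := ENNReal.ofReal (KG.bracket (t / R) ^ (1 - (d : ℝ)))
  set E := ENNReal.ofReal (√(A.toReal + 1) * KG.bracket (t / R) ^ ((1 - (d : ℝ)) / 2))
  have hE : E ≠ 0 := by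
    rw [ne_eq, ENNReal.ofReal_eq_zero, not_le]
    positivity
  have hAE : A * D ≤ E ^ 2 := by
    rw [← ENNReal.ofReal_toReal hA, ← ENNReal.ofReal_mul (by positivity),
      ← ENNReal.ofReal_pow (by positivity), mul_pow, Real.sq_sqrt (by positivity),
      ← Real.rpow_natCast (_ ^ _), ← Real.rpow_mul hb.le]
    have h1 : (1 - (d : ℝ)) / 2 * ((2 : ℕ) : ℝ) = 1 - d := by push_cast; ring
    rw [h1]
    gcongr
    linarith
  -- `f = ⟨∇⟩^{-s} g` for the `L²` representative `g` of `⟨∇⟩^s f`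
  rw [KG.sobolevNorm, KG.lpNorm, ENNReal.mul_iInf_of_ne hE ENNReal.ofReal_ne_top]
  refine le_iInf fun g ↦ ?_
  rw [ENNReal.mul_iInf_of_ne hE ENNReal.ofReal_ne_top]
  refine le_iInf fun hg ↦ ?_
  have key := KG.tsum_lpNorm_top_le
    (S := fun j ↦ KG.localizedFlow ψ α t χ hR j ∘L SchwartzMap.fourierMultiplierCLM ℂ
      (fun ξ ↦ ((KG.bracket ((2 * Real.pi) • ξ) ^ (-s) : ℝ) : ℂ)))
    (S' := fun j ↦ KG.dyadicBlock ψ j ∘L KG.propagator t ∘L KG.bracketNabla (-α) ∘L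
      KG.localize χ R ∘L KG.bracketNabla (-s))
    (fun j h ↦ by
      simp only [ContinuousLinearMap.comp_apply, KG.localizedFlow]
      rw [KG.bracketNabla_coe, KG.localize_coe χ hR, KG.bracketNabla_coe, KG.propagator,
        KG.multiplier_coe (KG.hasTemperateGrowth_propagator _ _), KG.dyadicBlock,
        KG.multiplier_coe (KG.hasTemperateGrowth_dyadicSymbol hψ j)])
    (ENNReal.mul_ne_top hA ENNReal.ofReal_ne_top : A * D ≠ ⊤)
    (fun k ↦ by
      rw [← KG.lintegral_sobolevWeight_fourierMultiplierCLM s]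
      exact h R hR hRR t _) g
  simp only [ContinuousLinearMap.comp_apply, hg, KG.bracketNabla_neg_bracketNabla] at key
  have h1 : ∀ y : ℝ≥0∞, (y ^ 2) ^ (1 / 2 : ℝ) = y := fun y ↦ by
    rw [← ENNReal.rpow_natCast, ← ENNReal.rpow_mul]
    norm_num
  calc KG.besovNorm ψ 0 ∞ 2 _ ≤ ((E * ‖g‖ₑ) ^ 2) ^ (1 / 2 : ℝ) := by
        rw [KG.besovNorm]
        gcongr
        simp only [mul_zero, ENNReal.rpow_zero, one_mul, ENNReal.rpow_ofNat]
        refine key.trans ?_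
        rw [mul_pow]
        gcongr
    _ = _ := h1 _
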